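/- Let $\mathbf X(t)$, $t>0$, be the symmetric Markov random flight in $\mathbb R^6$ with speed $c>0$ and switching rate $\lambda>0$: a particle starts at the origin, moves with constant speed $c$ in a direction uniformly distributed on the unit sphere, and at each event of a homogeneous Poisson process of rate $\lambda$ takes a new independent direction, uniform on the unit sphere. Write $p(\mathbf x,t)=p^{(s)}(\mathbf x,t)+p^{(ac)}(\mathbf x,t)$ for the density (in the sense of generalized functions) of the distribution of $\mathbf X(t)$, where $p^{(s)}$ is its singular part and $p^{(ac)}$ its absolutely continuous part. There is a unique nonnegative version of $p^{(ac)}(\cdot,t)$ that is continuous on the open ball $\|\mathbf x\|<ct$ and zero outside it; this version is used below. The symbol $\delta(r^2-\|\mathbf x\|^2)$ denotes the surface measure of the sphere $\|\mathbf x\|=r$ (so that $\frac{1}{\pi^3r^5}\,\delta(r^2-\|\mathbf x\|^2)$ is the uniform probability distribution on that sphere), and $$F(\alpha,\beta;\gamma;z)=\sum_{j=0}^\infty\frac{(\alpha)_j(\beta)_j}{(\gamma)_j}\frac{z^j}{j!}$$ is the Gauss hypergeometric function. Let $a>0$ and $\varrho>0$. Then under the slow diffusion condition $$\lambda\to0^+,\quad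 c\to0^+,\quad t\to\infty,\quad \lambda t\to a,\quad ct\to\varrho,$$ the density $p(\mathbf x,t)$ converges to $q(\mathbf x)=q^{(s)}(\mathbf x)+q^{(ac)}(\mathbf x)$, where $$q^{(s)}(\mathbf x)=\frac{e^{-a}}{\pi^3\varrho^5}\,\delta(\varrho^2-\|\mathbf x\|^2),$$ and, for $\|\mathbf x\|<\varrho$, $$q^{(ac)}(\mathbf x)=\frac{16\,a\,e^{-a}}{\pi^3\varrho^6}\left(1-\frac56\frac{\|\mathbf x\|^2}{\varrho^2}\right)+\frac{e^{-a}}{2\pi^3\varrho^6}\sum_{n=2}^\infty a^n(n+1)!\sum_{k=0}^{n+1}\frac{(k+1)(k+2)(n+2k+1)}{3^k\,(n-k+1)!\,(n+k-2)!}\,F\!\left(-(n+k-2),k+3;3;\frac{\|\mathbf x\|^2}{\varrho^2}\right),$$ while $q^{(ac)}(\mathbf x)=0$ for $\|\mathbf x\|\ge\varrho$. More precisely: the outer series converges absolutely for $\|\mathbf x\|<\varrho$; $q^{(ac)}\ge0$, and $q$ is the density of a probability distribution; $p^{(ac)}(\mathbf x,t)\to q^{(ac)}(\mathbf x)$ for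 every $\mathbf x$ with $\|\mathbf x\|\neq\varrho$; and, tested against bounded continuous functions on $\mathbb R^6$, the singular part $p^{(s)}$ converges to $q^{(s)}$ and the whole distribution of $\mathbf X(t)$ converges to the distribution with density $q$. -/

import Mathlib

open MeasureTheory Filter Topology
open scoped BoundedContinuousFunction Nat

noncomputable section

namespace RandomFlight

/-- Euclidean space `ℝᵐ`. -/
abbrev E (m : ℕ) : Type := EuclideanSpace ℝ (Fin m)

/-- The unit sphere of `ℝᵐ`. -/
abbrev UnitSphere (m : ℕ) : Type := Metric.sphere (0 : E m) 1

/-- The uniform probability distribution on the unit sphere (normalized surface measure). -/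
def uniformDirection (m : ℕ) : Measure (UnitSphere m) :=
  ((volume : Measure (E m)).toSphere Set.univ)⁻¹ • (volume : Measure (E m)).toSphere

/-- The law of the random input that drives the flight: independent pairs
(waiting time, direction), `k = 0, 1, 2, …`, where in each pair the waiting time is exponential
with rate `lam` and independent of the direction, which is uniform on the unit sphere.
Independent exponential waiting times are those of the homogeneous Poisson process of rate
`lam`. -/
def inputLaw (m : ℕ) (lam : ℝ) : Measure (ℕ → ℝ × UnitSphere m) :=
  Measure.infinitePi fun _ => (ProbabilityTheory.expMeasure lam).prod (uniformDirection m)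

/-- The instant of the `k`-th Poisson event (with `eventTime ω 0 = 0`, the start). -/
def eventTime {m : ℕ} (ω : ℕ → ℝ × UnitSphere m) (k : ℕ) : ℝ :=
  ∑ j ∈ Finset.range k, (ω j).1

/-- The number of Poisson events up to time `t` (almost surely finite). -/
def eventCount {m : ℕ} (t : ℝ) (ω : ℕ → ℝ × UnitSphere m) : ℕ :=
  {k : ℕ | eventTime ω (k + 1) ≤ t}.ncard

/-- The position at time `t` of the particle that starts at the origin, moves with speed `c` in
direction `(ω 0).2` and at the `k`-th Poisson event switches to direction `(ω k).2`. -/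
def position {m : ℕ} (c t : ℝ) (ω : ℕ → ℝ × UnitSphere m) : E m :=
  c • (∑ k ∈ Finset.range (eventCount t ω), (ω k).1 • ((ω k).2 : E m)
    + (t - eventTime ω (eventCount t ω)) • ((ω (eventCount t ω)).2 : E m))

/-- The distribution of `X(t)`, for the symmetric Markov random flight `X` in `ℝᵐ` with speed `c`
and switching rate `lam`. -/
def flightLaw (m : ℕ) (lam c t : ℝ) : Measure (E m) :=
  (inputLaw m lam).map (position c t)

/-- `f` is the density of the absolutely continuous component (in the Lebesgue decomposition) of
the distribution of `X(t)`, in its pointwise version: continuous inside the ball of radius `c t`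
and zero outside that open ball. -/
structure IsAcTransitionDensity (m : ℕ) (lam c t : ℝ) (f : E m → ℝ) : Prop where
  nonneg : ∀ x, 0 ≤ f x
  continuousOn : ContinuousOn f (Metric.ball 0 (c * t))
  eq_zero : ∀ x, x ∉ Metric.ball (0 : E m) (c * t) → f x = 0
  ae_eq_rnDeriv : (fun x => ENNReal.ofReal (f x)) =ᵐ[volume] (flightLaw m lam c t).rnDeriv volume

/-- The slow diffusion condition on `(lam, c, t)`:
`lam → 0+`, `c → 0+`, `t → ∞`, `lam * t → a`, `c * t → ρ`. -/
def slowDiffusion (a ρ : ℝ) : Filter (ℝ × ℝ × ℝ) :=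
  (𝓝[>] 0 ×ˢ 𝓝[>] 0 ×ˢ atTop)
    ⊓ comap (fun s : ℝ × ℝ × ℝ => s.1 * s.2.2) (𝓝 a)
    ⊓ comap (fun s : ℝ × ℝ × ℝ => s.2.1 * s.2.2) (𝓝 ρ)

/-- The surface measure of the sphere `‖x‖ = r` in `ℝᵐ`; this is what
`δ(r² - ‖x‖²)` denotes. -/
def sphereSurface (m : ℕ) (r : ℝ) : Measure (E m) :=
  ENNReal.ofReal (r ^ (m - 1)) •
    ((volume : Measure (E m)).toSphere).map (fun u : UnitSphere m => r • (u : E m))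

/-- The singular part `e^{-a} / (π³ ρ⁵) δ(ρ² - ‖x‖²)` of the stationary distribution. -/
def stationarySingular (a ρ : ℝ) : Measure (E 6) :=
  ENNReal.ofReal (Real.exp (-a) / (Real.pi ^ 3 * ρ ^ 5)) • sphereSurface 6 ρ

/-- The `n`-th term, `n ≥ 2`, of the outer series, with `z = ‖x‖² / ρ²`. -/
def seriesTerm (a z : ℝ) (n : ℕ) : ℝ :=
  a ^ n * ((n + 1)! : ℝ) *
    ∑ k ∈ Finset.range (n + 2),
      (((k : ℝ) + 1) * ((k : ℝ) + 2) * ((n : ℝ) + 2 * (k : ℝ) + 1)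
        / ((3 : ℝ) ^ k * ((n + 1 - k)! : ℝ) * ((n + k - 2)! : ℝ)))
      * ordinaryHypergeometric (-((n : ℝ) + (k : ℝ) - 2)) ((k : ℝ) + 3) (3 : ℝ) z

open Classical in
/-- The absolutely continuous part of the stationary density; the outer series runs over
`n = 2, 3, …`, i.e. over `n + 2` with `n : ℕ`. -/
def stationaryAc (a ρ : ℝ) (x : E 6) : ℝ :=
  if ‖x‖ < ρ then
    16 * a * Real.exp (-a) / (Real.pi ^ 3 * ρ ^ 6) * (1 - 5 / 6 * (‖x‖ ^ 2 / ρ ^ 2))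
      + Real.exp (-a) / (2 * Real.pi ^ 3 * ρ ^ 6)
        * ∑' n : ℕ, seriesTerm a (‖x‖ ^ 2 / ρ ^ 2) (n + 2)
  else 0

/-- The stationary distribution: singular part plus absolutely continuous part. -/
def stationaryLaw (a ρ : ℝ) : Measure (E 6) :=
  stationarySingular a ρ + volume.withDensity fun x => ENNReal.ofReal (stationaryAc a ρ x)

end RandomFlight

end

namespace RandomFlight

noncomputable section

/-! The slow diffusion limit rests on an exact identity, `flightLaw_eq_stationaryLaw`: for all
positive `lam`, `c`, `t` the law of the flight is `stationaryLaw (lam * t) (c * t)`. The convergence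
statements then reduce to continuity of the closed formula in `(a, ρ)`. Taking `lam = a`, `c = ρ`,
`t = 1` shows that the limit is itself a flight law, hence a probability measure with nonnegative
density.

The identity is proved by moments, separately on each event "exactly `n` switches". Conditioning on
the first waiting time and direction gives a renewal equation for the moments of `⟪α, X(t)⟫`. Beta
integrals cancel the binomial coefficients in it, so the recursion becomes multiplication of
ordinary power series: up to elementary factors, the `l`-th moment is `l! / (l + n)!` times the
`l`-th coefficient of `momentSeries ^ (n + 1)` (`flightMoment_eq`).

In dimension six the powers are explicit. With `B = ballotSeries 1`, which solves `B = 1 + X² B² /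
4`, one has `momentSeries = B - X² B³ / 12`. The binomial theorem and the ballot coefficients of the
powers of `B` give a finite sum over `k`, and its `k`-th term is the contribution of the `k`-th
hypergeometric polynomial in the claimed density (`sphereMoment_mul_sum`). The radial integrals of
that polynomial are evaluated by finite differences.

Finite measures of bounded support are determined by these moments. Since the formula is not visibly
nonnegative, it is first treated as a signed density; its sign comes out of the comparison with a
measure (`eq_withDensity_of_integral_inner_pow`). Summing over `n` gives the law. -/

/-! ### Ballot numbers and powers of the moment generating function -/

/-- Ballot numbers `m / (2 i + m) * (2 i + m choose i)`. -/
def ballot : ℕ → ℕ → ℝ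
  | 0, i => if i = 0 then 1 else 0
  | m + 1, i => ((m : ℝ) + 1) * ((2 * i + m)! : ℝ) / ((i ! : ℝ) * ((i + m + 1)! : ℝ))

lemma ballot_zero_right (m : ℕ) : ballot m 0 = 1 := by
  cases m with
  | zero => simp [ballot]
  | succ m =>
    simp only [ballot, mul_zero, zero_add, Nat.factorial_succ m, Nat.factorial_zero]
    have := Nat.factorial_ne_zero m
    push_cast
    field_simp

/-- Coefficient form of `C ^ (m + 1) = C ^ m + x C ^ (m + 2)` for the Catalan series `C = 1 + x C²`.
-/
lemma ballot_succ_succ (m i : ℕ) :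
    ballot (m + 1) (i + 1) = ballot m (i + 1) + ballot (m + 2) i := by
  have h1 : ((i ! : ℕ) : ℝ) ≠ 0 := by exact_mod_cast Nat.factorial_ne_zero i
  cases m with
  | zero =>
    have h2 : (((2 * i + 1)! : ℕ) : ℝ) ≠ 0 := by exact_mod_cast Nat.factorial_ne_zero _
    simp only [ballot, Nat.add_eq_zero_iff, one_ne_zero, and_false, if_false, zero_add, add_zero]
    rw [show 2 * (i + 1) = (2 * i + 1) + 1 by ring, show i + 1 + 1 = i + 2 by ring,
      Nat.factorial_succ (2 * i + 1), Nat.factorial_succ i, Nat.factorial_succ (i + 1),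
      Nat.factorial_succ i]
    push_cast
    field_simp
    ring
  | succ m =>
    have h2 : (((2 * i + m + 2)! : ℕ) : ℝ) ≠ 0 := by exact_mod_cast Nat.factorial_ne_zero _
    have h3 : (((i + m + 1)! : ℕ) : ℝ) ≠ 0 := by exact_mod_cast Nat.factorial_ne_zero _
    simp only [ballot]
    rw [show 2 * (i + 1) + (m + 1) = (2 * i + m + 2) + 1 by ring,
      show 2 * (i + 1) + m = 2 * i + m + 2 by ring,
      show i + 1 + (m + 1) + 1 = (i + m + 1 + 1) + 1 by ring,
      show i + 1 + m + 1 = i + m + 1 + 1 by ring,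
      show 2 * i + (m + 1 + 1) = 2 * i + m + 2 by ring,
      show i + (m + 1 + 1) + 1 = i + m + 1 + 1 + 1 by ring,
      Nat.factorial_succ (2 * i + m + 2), Nat.factorial_succ i, Nat.factorial_succ (i + m + 1 + 1),
      Nat.factorial_succ (i + m + 1)]
    push_cast
    field_simp
    ring

/-- The generating function `∑ i, ballot m i * (x² / 4) ^ i`. -/
def ballotSeries (m : ℕ) : PowerSeries ℝ :=
  PowerSeries.mk fun l => if Even l then ballot m (l / 2) / 4 ^ (l / 2) else 0

open PowerSeries in
lemma ballotSeries_zero : ballotSeries 0 = 1 := by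
  ext l
  rw [ballotSeries, coeff_mk, coeff_one]
  rcases Nat.even_or_odd' l with ⟨i, rfl | rfl⟩
  · rcases i with _ | i <;> simp [ballot]
  · simp

open PowerSeries in
lemma ballotSeries_succ (m : ℕ) :
    ballotSeries (m + 1) = ballotSeries m + X ^ 2 * (C (1 / 4 : ℝ) * ballotSeries (m + 2)) := by
  ext l
  rw [map_add, coeff_X_pow_mul']
  simp only [ballotSeries, coeff_mk, coeff_C_mul]
  rcases l with _ | _ | l
  · simp [ballot_zero_right]
  · simp
  · rw [show l + 1 + 1 - 2 = l by omega, show (l + 1 + 1) / 2 = l / 2 + 1 by omega]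
    have : Even (l + 1 + 1) ↔ Even l := by simp [Nat.even_add_one]
    simp only [this, le_add_iff_nonneg_left, zero_le, if_true]
    split_ifs
    · rw [ballot_succ_succ]
      field_simp
      ring
    · simp

-- The coefficient of degree `i` at index `m + 1` involves only degree `i` at index `m` and degree
-- `i - 2` at index `m + 2`. A strong induction on the degree with an inner induction on the index
-- therefore propagates agreement from index zero.
open PowerSeries in
lemma eq_of_recursion {U V : ℕ → PowerSeries ℝ} (κ : ℝ)
    (hU : ∀ m, U (m + 1) = U m + X ^ 2 * (C κ * U (m + 2)))
    (hV : ∀ m, V (m + 1) = V m + X ^ 2 * (C κ * V (m + 2))) (h0 : U 0 = V 0) (m : ℕ) :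
    U m = V m := by
  suffices h : ∀ i m, coeff i (U m) = coeff i (V m) from PowerSeries.ext fun i => h i m
  intro i
  induction i using Nat.strong_induction_on with
  | _ i ih =>
    intro m
    induction m with
    | zero => rw [h0]
    | succ m ihm =>
      rw [hU, hV, map_add, map_add, ihm, coeff_X_pow_mul', coeff_X_pow_mul']
      split_ifs with h
      · rw [coeff_C_mul, coeff_C_mul, ih (i - 2) (by omega)]
      · rfl

/-- For fixed `l`, multiplying by `ballotSeries l` and shifting the index by `l` both preserve the
recursion and agree at index zero, so the family is multiplicative in its index. -/
lemma ballotSeries_eq_pow (m : ℕ) : ballotSeries m = ballotSeries 1 ^ m := by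
  have key : ∀ l m, ballotSeries m * ballotSeries l = ballotSeries (m + l) := by
    intro l m
    refine eq_of_recursion (U := fun m => ballotSeries m * ballotSeries l)
      (V := fun m => ballotSeries (m + l)) (1 / 4) (fun m => ?_) (fun m => ?_) ?_ m
    · simp only [ballotSeries_succ m]; ring
    · rw [show m + 1 + l = (m + l) + 1 by ring, ballotSeries_succ,
        show m + 2 + l = (m + l) + 2 by ring]
    · simp [ballotSeries_zero]
  induction m with
  | zero => simp [ballotSeries_zero]
  | succ m ih => rw [← key, ih, pow_succ]

/-- The `i`-th moment of a coordinate of a uniformly distributed point of the unit sphere of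
`ℝ⁶`. -/
def sphereMoment (i : ℕ) : ℝ :=
  if Even i then 2 * (i ! : ℝ) / (4 ^ (i / 2) * ((i / 2)! : ℝ) * ((i / 2 + 2)! : ℝ)) else 0

/-- The generating function of `sphereMoment`. -/
def momentSeries : PowerSeries ℝ := PowerSeries.mk sphereMoment

-- This is where dimension six enters the algebra: the series factors as `B * (1 - X² B² / 12)` with
-- `B = ballotSeries 1`, so its powers have finite binomial expansions in powers of `B`.
open PowerSeries in
lemma momentSeries_eq :
    momentSeries = ballotSeries 1 - X ^ 2 * (C (1 / 12 : ℝ) * ballotSeries 3) := by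
  ext l
  rw [map_sub, coeff_X_pow_mul']
  simp only [momentSeries, sphereMoment, ballotSeries, coeff_mk, coeff_C_mul]
  rcases Nat.even_or_odd' l with ⟨i, rfl | rfl⟩
  · rcases i with _ | i
    · simp [ballot]
    · have h1 : ((i ! : ℕ) : ℝ) ≠ 0 := by exact_mod_cast Nat.factorial_ne_zero i
      have h2 : (((2 * i + 1)! : ℕ) : ℝ) ≠ 0 := by exact_mod_cast Nat.factorial_ne_zero _
      simp only [even_two, Even.mul_right, if_true, Nat.mul_div_cancel_left _ (zero_lt_two),
        show 2 ≤ 2 * (i + 1) by omega, show 2 * (i + 1) - 2 = 2 * i by omega, ballot]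
      rw [show 2 * (i + 1) = (2 * i + 1) + 1 by ring, show i + 1 + 2 = i + 1 + 1 + 1 by ring,
        show i + 2 + 1 = i + 1 + 1 + 1 by ring, show i + 1 + 0 + 1 = i + 1 + 1 by ring,
        show 2 * i + 1 + 1 + 0 = 2 * i + 1 + 1 by ring,
        show 2 * i + 2 = 2 * i + 1 + 1 by ring,
        Nat.factorial_succ (2 * i + 1), Nat.factorial_succ (i + 1 + 1), Nat.factorial_succ (i + 1),
        Nat.factorial_succ i]
      push_cast
      field_simp
      ring
  · have : ¬ Even (2 * i + 1 - 2) ∨ ¬ (2 ≤ 2 * i + 1) := by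
      rcases i with _ | i
      · right; omega
      · left; rw [show 2 * (i + 1) + 1 - 2 = 2 * i + 1 by omega]; simp
    rcases this with h | h <;> simp only [Nat.not_even_bit1, h, if_false, mul_zero, ite_self, sub_zero]

open PowerSeries in
lemma momentSeries_pow (N : ℕ) :
    momentSeries ^ N = ∑ k ∈ Finset.range (N + 1),
      X ^ (2 * k) * (C ((N.choose k : ℝ) * (-1 / 12) ^ k) * ballotSeries (N + 2 * k)) := by
  have : momentSeries = (X ^ 2 * (C (-1 / 12 : ℝ) * ballotSeries 2) + 1) * ballotSeries 1 := by
    rw [momentSeries_eq, ballotSeries_eq_pow 2, ballotSeries_eq_pow 3, neg_div, map_neg]; ring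
  rw [this, mul_pow, add_pow, Finset.sum_mul]
  refine Finset.sum_congr rfl fun k _ => ?_
  rw [ballotSeries_eq_pow 2, ballotSeries_eq_pow (N + 2 * k), map_mul, map_pow]
  simp only [one_pow, mul_pow, mul_one, map_natCast]
  ring

open PowerSeries in
lemma coeff_momentSeries_pow_even (N j : ℕ) :
    coeff (2 * j) (momentSeries ^ N) = ∑ k ∈ Finset.range (N + 1),
      if k ≤ j then (N.choose k : ℝ) * (-1 / 3) ^ k * ballot (N + 2 * k) (j - k) / 4 ^ j else 0 := by
  rw [momentSeries_pow, map_sum]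
  refine Finset.sum_congr rfl fun k _ => ?_
  rw [coeff_X_pow_mul']
  simp only [Nat.ofNat_pos, mul_le_mul_iff_right₀]
  split_ifs with h
  · obtain ⟨i, rfl⟩ := Nat.exists_eq_add_of_le h
    rw [coeff_C_mul, show 2 * (k + i) - 2 * k = 2 * i by omega, show k + i - k = i by omega]
    simp only [ballotSeries, coeff_mk, even_two, Even.mul_right, if_true,
      Nat.mul_div_cancel_left _ (zero_lt_two)]
    rw [show (-1 / 12 : ℝ) = (-1 / 3) / 4 by norm_num, div_pow (-1 / 3 : ℝ) 4, pow_add]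
    field_simp
  · rfl

open PowerSeries in
lemma coeff_momentSeries_pow_odd (N j : ℕ) : coeff (2 * j + 1) (momentSeries ^ N) = 0 := by
  rw [momentSeries_pow, map_sum]
  refine Finset.sum_eq_zero fun k _ => ?_
  rw [coeff_X_pow_mul']
  split_ifs with h
  · rw [coeff_C_mul, show 2 * j + 1 - 2 * k = 2 * (j - k) + 1 by omega]
    simp [ballotSeries]
  · rfl

/-! ### Finite differences and the hypergeometric polynomials -/

/-- The alternating binomial sum `∑ i, (-1) ^ i * (N choose i) * f i`. -/
def altSum (N : ℕ) (f : ℕ → ℝ) : ℝ :=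
  ∑ i ∈ Finset.range (N + 1), (-1) ^ i * (N.choose i : ℝ) * f i

lemma altSum_succ (N : ℕ) (f : ℕ → ℝ) :
    altSum (N + 1) f = altSum N f - altSum N fun i => f (i + 1) := by
  have := Finset.sum_choose_succ_mul (R := ℝ) (fun i _ => (-1) ^ i * f i) N
  simp only [altSum]
  have h : ∀ M : ℕ, ∀ g : ℕ → ℝ, ∑ i ∈ Finset.range M, (-1 : ℝ) ^ i * (N.choose i : ℝ) * g i
    = ∑ i ∈ Finset.range M, (N.choose i : ℝ) * ((-1) ^ i * g i) := fun M g =>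
      Finset.sum_congr rfl fun i _ => by ring
  have h' : ∀ M : ℕ, ∀ g : ℕ → ℝ,
    ∑ i ∈ Finset.range M, (-1 : ℝ) ^ i * ((N + 1).choose i : ℝ) * g i
    = ∑ i ∈ Finset.range M, ((N + 1).choose i : ℝ) * ((-1) ^ i * g i) := fun M g =>
      Finset.sum_congr rfl fun i _ => by ring
  rw [h, h, h', show N + 1 + 1 = N + 2 by ring]
  have h'' : ∑ i ∈ Finset.range (N + 1), (N.choose i : ℝ) * ((-1) ^ (i + 1) * f (i + 1))
    = - ∑ i ∈ Finset.range (N + 1), (N.choose i : ℝ) * ((-1) ^ i * f (i + 1)) := by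
    rw [← Finset.sum_neg_distrib]
    exact Finset.sum_congr rfl fun i _ => by ring
  rw [this, h'']
  ring

lemma altSum_add (N : ℕ) (f g : ℕ → ℝ) :
    altSum N (fun i => f i + g i) = altSum N f + altSum N g := by
  simp only [altSum, ← Finset.sum_add_distrib, mul_add]

lemma altSum_const_mul (N : ℕ) (r : ℝ) (f : ℕ → ℝ) :
    altSum N (fun i => r * f i) = r * altSum N f := by
  simp only [altSum, Finset.mul_sum]
  exact Finset.sum_congr rfl fun i _ => by ring

/-- The summand is a polynomial of degree `k` in `i`, and an `N`-th difference kills degrees below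
`N`. The shift `s` is carried along because one difference turns `(k, s)` into `(k - 1, s + 1)`; at
`k = 0` the factor `k` makes the truncated subtraction harmless. -/
lemma altSum_factorial_div (N k s : ℕ) (h : k < N) :
    altSum N (fun i => ((i + k + s)! : ℝ) / ((i + s)! : ℝ)) = 0 := by
  induction N generalizing k s with
  | zero => omega
  | succ N ih =>
    rw [altSum_succ]
    have key : ∀ i : ℕ, ((i + 1 + k + s)! : ℝ) / ((i + 1 + s)! : ℝ)
        = ((i + k + s)! : ℝ) / ((i + s)! : ℝ)
          + k * (((i + (k - 1) + (s + 1))! : ℝ) / ((i + (s + 1))! : ℝ)) := by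
      intro i
      rcases k with _ | k
      · simp [Nat.factorial_ne_zero]
      · rw [show i + 1 + (k + 1) + s = (i + k + s + 1) + 1 by ring, show i + 1 + s = i + s + 1 by ring,
          show i + (k + 1) + s = i + k + s + 1 by ring,
          show i + (k + 1 - 1) + (s + 1) = i + k + s + 1 by omega,
          show i + (s + 1) = i + s + 1 by ring, Nat.factorial_succ (i + k + s + 1),
          Nat.factorial_succ (i + s)]
        have := Nat.factorial_ne_zero (i + s)
        push_cast
        field_simp
        ring
    simp only [key]
    rw [altSum_add, altSum_const_mul]
    rcases Nat.eq_zero_or_pos k with rfl | hk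
    · simp
    · rw [ih (k - 1) (s + 1) (by omega)]
      ring

lemma altSum_inv (N s : ℕ) :
    altSum N (fun i => 1 / ((i : ℝ) + s + 1)) = (N ! : ℝ) * (s ! : ℝ) / ((N + s + 1)! : ℝ) := by
  induction N generalizing s with
  | zero =>
    have := Nat.factorial_ne_zero s
    simp only [altSum, zero_add, Finset.range_one, Finset.sum_singleton, Nat.factorial_succ s]
    push_cast
    simp
    field_simp
  | succ N ih =>
    rw [altSum_succ, ih s]
    have h2 := ih (s + 1)
    have : (fun i : ℕ => 1 / (((i + 1 : ℕ) : ℝ) + s + 1))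
        = fun i : ℕ => 1 / ((i : ℝ) + ((s + 1 : ℕ) : ℝ) + 1) := by
      funext i; push_cast; ring_nf
    rw [this, h2, show N + (s + 1) + 1 = (N + s + 1) + 1 by ring,
      show N + 1 + s + 1 = (N + s + 1) + 1 by ring, Nat.factorial_succ (N + s + 1),
      Nat.factorial_succ N, Nat.factorial_succ s]
    have := Nat.factorial_ne_zero (N + s + 1)
    push_cast
    field_simp
    ring

/-- Only the residue at `i = -(j + 3)` survives. Writing `i + k + 3 = (i + j + 3) + (k - j)`, the
first summand cancels the pole and leaves a polynomial of degree below `N`, which contributes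
nothing. The resulting falling factorial of `j` vanishes for `j < k`, exactly where the binomial
expansion of the power series has no term. -/
lemma altSum_factorial_div_mul_inv (N k j : ℕ) (h : k ≤ N) :
    altSum N (fun i => ((i + k + 2)! : ℝ) / ((i + 2)! : ℝ) * (1 / ((i : ℝ) + j + 3)))
      = (-1) ^ k * (j.descFactorial k : ℝ) * ((j + 2)! : ℝ) * (N ! : ℝ) / ((N + j + 3)! : ℝ) := by
  induction k with
  | zero =>
    have := altSum_inv N (j + 2)
    rw [show N + (j + 2) + 1 = N + j + 3 by ring] at this
    simp only [add_zero, pow_zero, Nat.descFactorial_zero, Nat.cast_one, one_mul]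
    rw [mul_comm ((j + 2)! : ℝ), ← this]
    congr 1
    funext i
    rw [div_self (by exact_mod_cast Nat.factorial_ne_zero _), one_mul]
    push_cast
    ring_nf
  | succ k ih =>
    have key : ∀ i : ℕ, ((i + (k + 1) + 2)! : ℝ) / ((i + 2)! : ℝ) * (1 / ((i : ℝ) + j + 3))
        = ((i + k + 2)! : ℝ) / ((i + 2)! : ℝ)
          + ((k : ℝ) - j) * (((i + k + 2)! : ℝ) / ((i + 2)! : ℝ) * (1 / ((i : ℝ) + j + 3))) := by
      intro i
      rw [show i + (k + 1) + 2 = i + k + 2 + 1 by ring, Nat.factorial_succ]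
      have := Nat.factorial_ne_zero (i + 2)
      have : (i : ℝ) + j + 3 ≠ 0 := by positivity
      push_cast
      field_simp
      ring
    simp only [key]
    rw [altSum_add, altSum_const_mul, ih (by omega), altSum_factorial_div N k 2 (by omega),
      Nat.descFactorial_succ]
    have : ((j.descFactorial k : ℕ) : ℝ) * ((k : ℝ) - j)
        = - (((j - k : ℕ) : ℝ) * ((j.descFactorial k : ℕ) : ℝ)) := by
      rcases le_or_gt k j with hkj | hkj
      · rw [Nat.cast_sub hkj]; ring
      · rw [Nat.descFactorial_of_lt hkj]; simp
    push_cast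
    linear_combination ((-1) ^ k * ((j + 2)! : ℝ) * (N ! : ℝ) / ((N + j + 3)! : ℝ)) * this

/-- The coefficients of the polynomial `F(-N, k + 3; 3; z)`. -/
def hypCoeff (N k i : ℕ) : ℝ :=
  (-1) ^ i * (N.choose i : ℝ) * (2 * ((i + k + 2)! : ℝ) / (((k + 2)! : ℝ) * ((i + 2)! : ℝ)))

/-- Here `1 / (i + j + 3)` is the integral of `z ^ (i + j + 2)` over `[0, 1]`, so this is the radial
moment of the hypergeometric polynomial. -/
lemma sum_hypCoeff_div (N k j : ℕ) (h : k ≤ N) :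
    ∑ i ∈ Finset.range (N + 1), hypCoeff N k i * (1 / ((i : ℝ) + j + 3))
      = 2 / ((k + 2)! : ℝ) *
        ((-1) ^ k * (j.descFactorial k : ℝ) * ((j + 2)! : ℝ) * (N ! : ℝ) / ((N + j + 3)! : ℝ)) := by
  rw [← altSum_factorial_div_mul_inv N k j h, altSum, Finset.mul_sum]
  refine Finset.sum_congr rfl fun i _ => ?_
  simp only [hypCoeff]
  field_simp

lemma ordinaryHypergeometric_eq_sum (N k : ℕ) (z : ℝ) :
    ordinaryHypergeometric (-(N : ℝ)) ((k : ℝ) + 3) (3 : ℝ) z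
      = ∑ i ∈ Finset.range (N + 1), hypCoeff N k i * z ^ i := by
  rw [ordinaryHypergeometric_eq_tsum]
  simp only
  rw [tsum_eq_sum (s := Finset.range (N + 1))]
  · refine Finset.sum_congr rfl fun i _ => ?_
    have h1 : (ascPochhammer ℝ i).eval (-(N : ℝ)) = (-1) ^ i * ((i ! : ℝ) * (N.choose i : ℝ)) := by
      rw [ascPochhammer_eval_neg_eq_descPochhammer, descPochhammer_eval_eq_descFactorial,
        Nat.descFactorial_eq_factorial_mul_choose]
      push_cast
      ring
    have h2 : ∀ l : ℕ, (ascPochhammer ℝ i).eval ((l : ℝ) + 3) = ((i + l + 2)! : ℝ) / ((l + 2)! : ℝ) := by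
      intro l
      have h3 := Nat.factorial_mul_ascFactorial (l + 2) i
      have : ((l : ℝ) + 3) = ((l + 2 + 1 : ℕ) : ℝ) := by push_cast; ring
      rw [this, ascPochhammer_nat_eq_natCast_ascFactorial, eq_div_iff
        (by exact_mod_cast Nat.factorial_ne_zero _), mul_comm]
      rw [show i + l + 2 = l + 2 + i by ring]
      exact_mod_cast h3
    have h4 := h2 0
    simp only [Nat.cast_zero, zero_add, add_zero] at h4
    rw [h1, h2, h4, smul_eq_mul, hypCoeff]
    have := Nat.factorial_ne_zero i
    have := Nat.factorial_ne_zero (i + 2)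
    have := Nat.factorial_ne_zero (k + 2)
    simp only [Nat.factorial_two]
    push_cast
    field_simp
  · intro i hi
    rw [(ascPochhammer_eval_eq_zero_iff i _).2 ⟨N, by simpa [Nat.lt_succ_iff] using hi, by simp⟩]
    simp

/-- The prefactor of the `k`-th hypergeometric function in `seriesTerm 1 z n`, `n ≥ 2`. -/
def innerCoeff (n k : ℕ) : ℝ :=
  ((n + 1)! : ℝ) * (((k : ℝ) + 1) * ((k : ℝ) + 2) * ((n : ℝ) + 2 * (k : ℝ) + 1)
    / ((3 : ℝ) ^ k * ((n + 1 - k)! : ℝ) * ((n + k - 2)! : ℝ)))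

lemma seriesTerm_eq (a z : ℝ) (n : ℕ) (hn : 2 ≤ n) :
    seriesTerm a z n = a ^ n * ∑ k ∈ Finset.range (n + 2),
      innerCoeff n k * ∑ i ∈ Finset.range (n + k - 2 + 1), hypCoeff (n + k - 2) k i * z ^ i := by
  rw [seriesTerm, mul_assoc]
  congr 1
  rw [Finset.mul_sum]
  refine Finset.sum_congr rfl fun k _ => ?_
  rw [← ordinaryHypergeometric_eq_sum, innerCoeff, Nat.cast_sub (by omega)]
  push_cast
  ring

-- The two sides agree term by term in `k`, and for `k > j` both terms vanish. The factor `1 / 4`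
-- combines the prefactor `1 / 2` of the density with the `1 / 2` from `1 / (2 j + 2 i + 6)` in the
-- radial integral.
open PowerSeries in
lemma sphereMoment_mul_sum (n j : ℕ) (hn : 2 ≤ n) :
    sphereMoment (2 * j) * (1 / 4 * ∑ k ∈ Finset.range (n + 2), innerCoeff n k *
      ∑ i ∈ Finset.range (n + k - 2 + 1), hypCoeff (n + k - 2) k i * (1 / ((i : ℝ) + j + 3)))
      = ((2 * j)! : ℝ) / ((2 * j + n)! : ℝ) * coeff (2 * j) (momentSeries ^ (n + 1)) := by
  rw [coeff_momentSeries_pow_even, Finset.mul_sum, Finset.mul_sum, Finset.mul_sum]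
  refine Finset.sum_congr rfl fun k hk => ?_
  have hk : k ≤ n + 1 := by simpa [Nat.lt_succ_iff] using hk
  rw [sum_hypCoeff_div _ _ _ (by omega)]
  simp only [sphereMoment, even_two, Even.mul_right, if_true, innerCoeff,
      Nat.mul_div_cancel_left _ (zero_lt_two)]
  split_ifs with hkj
  · obtain ⟨l, rfl⟩ := Nat.exists_eq_add_of_le hkj
    obtain ⟨m, rfl⟩ := Nat.exists_eq_add_of_le hn
    have hb : ballot (2 + m + 1 + 2 * k) (k + l - k)
        = ((m : ℝ) + 2 * k + 3) * ((2 * (k + l) + (2 + m))! : ℝ)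
          / ((l ! : ℝ) * ((m + 2 * k + l + 3)! : ℝ)) := by
      rw [show 2 + m + 1 + 2 * k = (m + 2 * k + 2) + 1 by ring, show k + l - k = l by omega, ballot,
        show 2 * l + (m + 2 * k + 2) = 2 * (k + l) + (2 + m) by ring,
        show l + (m + 2 * k + 2) + 1 = m + 2 * k + l + 3 by ring]
      push_cast
      ring
    have hd : ((k + l).descFactorial k : ℝ) = ((k + l)! : ℝ) / (l ! : ℝ) := by
      rw [eq_div_iff (by exact_mod_cast Nat.factorial_ne_zero _), mul_comm]
      have := Nat.factorial_mul_descFactorial (n := k + l) (k := k) (by omega)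
      rw [show k + l - k = l by omega] at this
      exact_mod_cast this
    have hc : ((2 + m + 1).choose k : ℝ)
        = ((2 + m + 1)! : ℝ) / ((k ! : ℝ) * ((2 + m + 1 - k)! : ℝ)) := Nat.cast_choose ℝ hk
    rw [hb, hd, hc, show 2 + m + k - 2 = m + k by omega,
      show m + k + (k + l) + 3 = m + 2 * k + l + 3 by ring, Nat.factorial_succ (k + 1),
      Nat.factorial_succ k, neg_div, neg_pow (1 / 3 : ℝ), one_div_pow]
    have h1 := Nat.factorial_ne_zero k
    have h2 := Nat.factorial_ne_zero l
    have h3 := Nat.factorial_ne_zero (k + l)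
    have h4 := Nat.factorial_ne_zero (k + l + 2)
    have h5 := Nat.factorial_ne_zero (m + k)
    have h6 := Nat.factorial_ne_zero (2 + m + 1 - k)
    have h7 := Nat.factorial_ne_zero (m + 2 * k + l + 3)
    have h8 := Nat.factorial_ne_zero (2 * (k + l) + (2 + m))
    push_cast
    field_simp
    ring
  · rw [Nat.descFactorial_of_lt (by omega)]
    simp

-- One switch needs its own formula: the general one would contain `(n + k - 2)!` at `n = 1`, `k =
-- 0`. The constant is `8 = 16 / 2`, the `1 / 2` again coming from the radial integral.
open PowerSeries in
lemma sphereMoment_mul_one_switch (j : ℕ) :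
    sphereMoment (2 * j) * (8 * (1 / ((j : ℝ) + 3) - 5 / 6 * (1 / ((j : ℝ) + 4))))
      = ((2 * j)! : ℝ) / ((2 * j + 1)! : ℝ) * coeff (2 * j) (momentSeries ^ 2) := by
  rw [coeff_momentSeries_pow_even]
  simp only [sphereMoment, even_two, Even.mul_right, if_true,
      Nat.mul_div_cancel_left _ (zero_lt_two), Finset.sum_range_succ, Finset.range_zero,
      Finset.sum_empty, zero_add]
  -- The terms `k = 0, 1, 2` of the square are all present only when `j ≥ 2`.
  rcases j with _ | _ | j
  · norm_num [ballot]
  · norm_num [ballot, Nat.factorial]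
  · simp only [zero_le, if_true, show 1 ≤ j + 1 + 1 by omega, show 2 ≤ j + 1 + 1 by omega,
      show j + 1 + 1 - 1 = j + 1 by omega, show j + 1 + 1 - 2 = j by omega,
      show j + 1 + 1 - 0 = j + 2 by omega, ballot]
    rw [show 2 * (j + 1 + 1) + 1 = (2 * j + 4) + 1 by ring, show 2 * (j + 1 + 1) = 2 * j + 4 by ring,
      show 2 * (j + 1) + 3 = (2 * j + 4) + 1 by ring,
      show 2 * j + 5 = (2 * j + 4) + 1 by ring,
      show j + 1 + 3 + 1 = j + 1 + 1 + 1 + 1 + 1 by ring,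
      show j + 2 = j + 1 + 1 by ring, show j + 1 + 1 + 2 = j + 1 + 1 + 1 + 1 by ring]
    simp only [Nat.factorial_succ (2 * j + 4), Nat.factorial_succ (j + 1 + 1 + 1 + 1 + 1),
      Nat.factorial_succ (j + 1 + 1 + 1 + 1), Nat.factorial_succ (j + 1 + 1 + 1),
      Nat.factorial_succ (j + 1 + 1), Nat.factorial_succ (j + 1), Nat.factorial_succ j]
    have h1 := Nat.factorial_ne_zero j
    have h2 := Nat.factorial_ne_zero (2 * j + 4)
    have h3 : Nat.choose 2 1 = 2 := rfl
    simp only [h3, Nat.choose_zero_right, Nat.choose_self]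
    push_cast
    have : (j : ℝ) + 2 ≠ 0 := by positivity
    have : (j : ℝ) + 3 ≠ 0 := by positivity
    have : (j : ℝ) + 4 ≠ 0 := by positivity
    have : (j : ℝ) + 5 ≠ 0 := by positivity
    have : (j : ℝ) + 6 ≠ 0 := by positivity
    have : 2 * (j : ℝ) + 5 ≠ 0 := by positivity
    field_simp
    ring

/-! ### Moments of the uniform direction and polar integration -/

instance (m : ℕ) [NeZero m] : IsProbabilityMeasure (uniformDirection m) where
  measure_univ := by
    rw [uniformDirection, Measure.smul_apply, smul_eq_mul]
    exact ENNReal.inv_mul_cancel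
      (Measure.measure_univ_ne_zero.2 (Measure.toSphere_ne_zero _)) (measure_ne_top _ _)

lemma integral_inner_pow_mul_norm_eq (α : E 6) (m : ℕ) (h : ℝ → ℝ) :
    ∫ x : E 6, (inner ℝ α x) ^ m * h ‖x‖
      = (∫ u : UnitSphere 6, (inner ℝ α (u : E 6)) ^ m ∂(volume : Measure (E 6)).toSphere)
        * ∫ r in Set.Ioi (0 : ℝ), r ^ 5 * (r ^ m * h r) := by
  have hdim : Module.finrank ℝ (E 6) - 1 = 5 := by simp
  calc
    ∫ x : E 6, (inner ℝ α x) ^ m * h ‖x‖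
      = ∫ x : ({(0 : E 6)}ᶜ : Set (E 6)), (inner ℝ α x.1) ^ m * h ‖x.1‖
          ∂((volume : Measure (E 6)).comap (↑)) := by
      rw [integral_subtype_comap (measurableSet_singleton _).compl
        fun x : E 6 => (inner ℝ α x) ^ m * h ‖x‖, restrict_compl_singleton]
    _ = ∫ p, (inner ℝ α (p.1 : E 6)) ^ m * ((p.2 : ℝ) ^ m * h p.2)
          ∂(volume : Measure (E 6)).toSphere.prod
            (.volumeIoiPow (Module.finrank ℝ (E 6) - 1)) := by
      rw [← (volume : Measure (E 6)).measurePreserving_homeomorphUnitSphereProd.integral_comp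
        (Homeomorph.measurableEmbedding _)]
      refine integral_congr_ae (Eventually.of_forall fun x => ?_)
      have hx : ‖(x : E 6)‖ ≠ 0 := norm_ne_zero_iff.2 x.2
      simp only [homeomorphUnitSphereProd_apply_fst_coe, homeomorphUnitSphereProd_apply_snd_coe,
        inner_smul_right]
      rw [← mul_assoc, ← mul_pow, mul_right_comm, inv_mul_cancel₀ hx, one_mul]
    _ = (∫ u : UnitSphere 6, (inner ℝ α (u : E 6)) ^ m ∂(volume : Measure (E 6)).toSphere)
        * ∫ r : Set.Ioi (0 : ℝ), (r : ℝ) ^ m * h r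
            ∂.volumeIoiPow (Module.finrank ℝ (E 6) - 1) :=
      integral_prod_mul (fun u : UnitSphere 6 => (inner ℝ α (u : E 6)) ^ m)
        fun r : Set.Ioi (0 : ℝ) => (r : ℝ) ^ m * h r
    _ = _ := by
      rw [hdim]
      congr 1
      simp only [Measure.volumeIoiPow, ENNReal.ofReal]
      rw [integral_withDensity_eq_integral_smul,
        integral_subtype_comap measurableSet_Ioi
          fun a : ℝ => Real.toNNReal (a ^ 5) • (a ^ m * h a),
        setIntegral_congr_fun measurableSet_Ioi fun x hx => ?_]
      · rw [NNReal.smul_def, Real.coe_toNNReal _ (pow_nonneg (le_of_lt hx) _), smul_eq_mul]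
      · exact (measurable_subtype_coe.pow_const _).real_toNNReal

lemma integral_Ioi_pow_mul_exp_neg_sq (n : ℕ) :
    ∫ r in Set.Ioi (0 : ℝ), r ^ n * Real.exp (-r ^ 2) = Real.Gamma ((n + 1) / 2) / 2 := by
  have := integral_rpow_mul_exp_neg_rpow (p := 2) (q := n) two_pos (by
    have : (0 : ℝ) ≤ n := n.cast_nonneg
    linarith)
  simp only [Real.rpow_natCast, Real.rpow_ofNat] at this
  rw [this]
  ring

lemma integral_even_pow_mul_exp_neg_sq (j : ℕ) :
    ∫ r : ℝ, r ^ (2 * j) * Real.exp (-r ^ 2)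
      = √Real.pi * ((2 * j)! : ℝ) / (4 ^ j * (j ! : ℝ)) := by
  have h1 : ∀ r : ℝ, r ^ (2 * j) * Real.exp (-r ^ 2) = |r| ^ (2 * j) * Real.exp (-|r| ^ 2) := by
    intro r
    rw [pow_mul, pow_mul, sq_abs]
  rw [integral_congr_ae (Eventually.of_forall h1), integral_comp_abs (f := fun r : ℝ => r ^ (2 * j) * Real.exp (-r ^ 2)),
    integral_Ioi_pow_mul_exp_neg_sq]
  have h2 : (((2 * j : ℕ) : ℝ) + 1) / 2 = (j : ℝ) + 1 / 2 := by push_cast; ring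
  rw [h2, Real.Gamma_nat_add_half]
  have h3 : ((2 * j)! : ℝ) = (2 : ℝ) ^ j * (j ! : ℝ) * ((2 * j - 1)‼ : ℝ) := by
    rcases j with _ | j
    · simp
    · rw [show 2 * (j + 1) = (2 * j + 1) + 1 by ring, Nat.factorial_eq_mul_doubleFactorial,
        show 2 * j + 1 + 1 = 2 * (j + 1) by ring, Nat.doubleFactorial_two_mul,
        show 2 * (j + 1) - 1 = 2 * j + 1 by omega]
      push_cast
      ring
  have := Nat.factorial_ne_zero j
  rw [h3, show (4 : ℝ) = 2 * 2 by norm_num, mul_pow]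
  field_simp

lemma integral_odd_pow_mul_exp_neg_sq (j : ℕ) :
    ∫ r : ℝ, r ^ (2 * j + 1) * Real.exp (-r ^ 2) = 0 := by
  have h := integral_neg_eq_self (fun r : ℝ => r ^ (2 * j + 1) * Real.exp (-r ^ 2)) volume
  have h2 : ∀ r : ℝ, (-r) ^ (2 * j + 1) * Real.exp (-(-r) ^ 2)
      = - (r ^ (2 * j + 1) * Real.exp (-r ^ 2)) := by
    intro r
    rw [Odd.neg_pow (by simp), neg_sq]
    ring
  simp_rw [h2, integral_neg] at h
  linarith

lemma integral_apply_zero_pow_mul_exp_neg_norm_sq (m : ℕ) :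
    ∫ x : E 6, (x 0) ^ m * Real.exp (-‖x‖ ^ 2)
      = (∫ r : ℝ, r ^ m * Real.exp (-r ^ 2)) * √Real.pi ^ 5 := by
  rw [← (PiLp.volume_preserving_toLp (Fin 6)).integral_comp
    (MeasurableEquiv.toLp 2 _).measurableEmbedding]
  have h : ∀ y : Fin 6 → ℝ, (WithLp.toLp 2 y : E 6) 0 ^ m * Real.exp (-‖(WithLp.toLp 2 y : E 6)‖ ^ 2)
      = ∏ i, (if i = 0 then fun r : ℝ => r ^ m * Real.exp (-r ^ 2)
          else fun r : ℝ => Real.exp (-r ^ 2)) (y i) := by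
    intro y
    rw [EuclideanSpace.norm_sq_eq]
    simp only [Fin.prod_univ_succ, Fin.sum_univ_succ, Real.norm_eq_abs, sq_abs]
    simp [Fin.succ_ne_zero, Real.exp_add]
    ring
  simp_rw [h]
  rw [integral_fintype_prod_volume_eq_prod]
  rw [Fin.prod_univ_succ]
  have hg : ∫ r : ℝ, Real.exp (-r ^ 2) = √Real.pi := by
    have := integral_gaussian 1
    simpa using this
  simp [Fin.succ_ne_zero, hg]

/-- A reflection carries `α` to a multiple of the first basis vector, and it preserves both volume
and norm. -/
lemma integral_inner_pow_mul_exp_neg_norm_sq (α : E 6) (m : ℕ) :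
    ∫ x : E 6, (inner ℝ α x) ^ m * Real.exp (-‖x‖ ^ 2)
      = ‖α‖ ^ m * ∫ x : E 6, (x 0) ^ m * Real.exp (-‖x‖ ^ 2) := by
  set β : E 6 := ‖α‖ • EuclideanSpace.single 0 1 with hβ
  have hn : ‖α‖ = ‖β‖ := by simp [hβ, norm_smul]
  set R := (Submodule.span ℝ {α - β})ᗮ.reflection with hR
  have hRα : R α = β := Submodule.reflection_sub hn
  rw [← integral_const_mul,
    ← R.measurePreserving.integral_comp R.toHomeomorph.measurableEmbedding
      (fun x : E 6 => ‖α‖ ^ m * (x 0 ^ m * Real.exp (-‖x‖ ^ 2)))]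
  refine integral_congr_ae (Eventually.of_forall fun x => ?_)
  have h1 : inner ℝ α x = ‖α‖ * (R x) 0 := by
    rw [← R.inner_map_map, hRα, hβ, inner_smul_left, EuclideanSpace.inner_single_left]
    simp
  simp only [h1, R.norm_map, mul_pow, mul_assoc]

/-- A Gaussian integral is evaluated twice: in polar coordinates it is the sphere moment times a
Gamma value, and in Cartesian coordinates it splits into one-dimensional integrals. -/
lemma integral_toSphere_inner_pow (α : E 6) (m : ℕ) :
    ∫ u : UnitSphere 6, (inner ℝ α (u : E 6)) ^ m ∂(volume : Measure (E 6)).toSphere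
      = ‖α‖ ^ m * (Real.pi ^ 3 * sphereMoment m) := by
  have h1 := integral_inner_pow_mul_norm_eq α m fun r => Real.exp (-r ^ 2)
  have h2 : ∫ r in Set.Ioi (0 : ℝ), r ^ 5 * (r ^ m * Real.exp (-r ^ 2))
      = Real.Gamma (((5 + m : ℕ) + 1) / 2) / 2 := by
    rw [← integral_Ioi_pow_mul_exp_neg_sq]
    simp only [pow_add, mul_assoc]
  have hpi : √Real.pi ^ 6 = Real.pi ^ 3 := by
    rw [show 6 = 2 * 3 by norm_num, pow_mul, Real.sq_sqrt Real.pi_pos.le]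
  rw [h2, integral_inner_pow_mul_exp_neg_norm_sq,
    integral_apply_zero_pow_mul_exp_neg_norm_sq] at h1
  have hG : 0 < Real.Gamma (((5 + m : ℕ) + 1) / 2) := Real.Gamma_pos_of_pos (by positivity)
  rcases Nat.even_or_odd' m with ⟨j, rfl | rfl⟩
  · have h3 : (((5 + 2 * j : ℕ) : ℝ) + 1) / 2 = ((j + 2 : ℕ) : ℝ) + 1 := by push_cast; ring
    rw [h3, Real.Gamma_nat_eq_factorial, integral_even_pow_mul_exp_neg_sq] at h1
    have h4 := Nat.factorial_ne_zero (j + 2)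
    have h5 := Nat.factorial_ne_zero j
    simp only [sphereMoment, even_two, Even.mul_right, if_true,
      Nat.mul_div_cancel_left _ (zero_lt_two)]
    rw [← hpi]
    field_simp at h1 ⊢
    linear_combination -h1
  · rw [integral_odd_pow_mul_exp_neg_sq] at h1
    simp only [sphereMoment, Nat.not_even_bit1, if_false, mul_zero]
    have := hG.ne'
    simp only [zero_mul, mul_zero, zero_eq_mul, div_eq_zero_iff, this, OfNat.ofNat_ne_zero,
      or_false] at h1
    exact h1

lemma toSphere_univ : (volume : Measure (E 6)).toSphere Set.univ = ENNReal.ofReal (Real.pi ^ 3) := by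
  have := integral_toSphere_inner_pow 0 0
  simp only [pow_zero, integral_const, smul_eq_mul, mul_one, sphereMoment, one_mul] at this
  rw [← ENNReal.ofReal_toReal (measure_ne_top _ _)]
  congr 1
  rw [← measureReal_def, this]
  simp

lemma integral_uniformDirection_inner_pow (α : E 6) (m : ℕ) :
    ∫ u : UnitSphere 6, (inner ℝ α (u : E 6)) ^ m ∂uniformDirection 6
      = ‖α‖ ^ m * sphereMoment m := by
  rw [uniformDirection, integral_smul_measure, integral_toSphere_inner_pow, toSphere_univ,
    ENNReal.toReal_inv, ENNReal.toReal_ofReal (by positivity), smul_eq_mul]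
  field_simp

lemma integral_inner_pow_mul_norm_pow_ball (α : E 6) (m i : ℕ) {ρ : ℝ} (hρ : 0 < ρ) :
    ∫ x in Metric.ball (0 : E 6) ρ, (inner ℝ α x) ^ m * (‖x‖ ^ 2 / ρ ^ 2) ^ i
      = ‖α‖ ^ m * (Real.pi ^ 3 * sphereMoment m) * (ρ ^ (m + 6) / ((m : ℝ) + 2 * i + 6)) := by
  rw [← integral_indicator measurableSet_ball]
  have h : ∀ x : E 6, (Metric.ball (0 : E 6) ρ).indicator
      (fun x => (inner ℝ α x) ^ m * (‖x‖ ^ 2 / ρ ^ 2) ^ i) x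
      = (inner ℝ α x) ^ m * (Set.Iio ρ).indicator (fun r => (r ^ 2 / ρ ^ 2) ^ i) ‖x‖ := by
    intro x
    by_cases hx : ‖x‖ < ρ
    · rw [Set.indicator_of_mem (mem_ball_zero_iff.2 hx), Set.indicator_of_mem (Set.mem_Iio.2 hx)]
    · rw [Set.indicator_of_notMem (fun h => hx (mem_ball_zero_iff.1 h)),
        Set.indicator_of_notMem (fun h : ‖x‖ ∈ Set.Iio ρ => hx h),
        mul_zero]
  simp_rw [h]
  rw [integral_inner_pow_mul_norm_eq, integral_toSphere_inner_pow]
  congr 1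
  have h2 : ∀ r : ℝ, r ^ 5 * (r ^ m * (Set.Iio ρ).indicator (fun r => (r ^ 2 / ρ ^ 2) ^ i) r)
      = (Set.Iio ρ).indicator (fun r => r ^ (5 + m + 2 * i) / ρ ^ (2 * i)) r := by
    intro r
    simp only [Set.indicator_apply]
    split_ifs
    · rw [div_pow, ← pow_mul, ← pow_mul]; ring
    · simp
  simp_rw [h2]
  rw [setIntegral_indicator measurableSet_Iio, Set.Ioi_inter_Iio, ← integral_Ioc_eq_integral_Ioo,
    ← intervalIntegral.integral_of_le hρ.le, intervalIntegral.integral_div, integral_pow]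
  have : (m : ℝ) + 2 * i + 6 ≠ 0 := by positivity
  rw [zero_pow (by omega), sub_zero]
  push_cast
  rw [show (5 : ℝ) + m + 2 * i + 1 = m + 2 * i + 6 by ring,
    show 5 + m + 2 * i + 1 = (m + 6) + 2 * i by ring, pow_add ρ (m + 6)]
  field_simp

/-! ### Renewal equation and moments for a fixed number of events -/

/-- The sequence with head `p.1` and tail `p.2`. -/
def consSeq {Y : Type*} (p : Y × (ℕ → Y)) : ℕ → Y
  | 0 => p.1
  | k + 1 => p.2 k

@[simp] lemma consSeq_zero {Y : Type*} (p : Y × (ℕ → Y)) : consSeq p 0 = p.1 := rfl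

@[simp] lemma consSeq_succ {Y : Type*} (p : Y × (ℕ → Y)) (k : ℕ) : consSeq p (k + 1) = p.2 k := rfl

lemma measurable_consSeq {Y : Type*} [MeasurableSpace Y] : Measurable (consSeq (Y := Y)) := by
  refine measurable_pi_lambda _ fun k => ?_
  rcases k with _ | k
  · exact measurable_fst
  · exact (measurable_pi_apply k).comp measurable_snd

-- The infinite product measure is characterised by its values on finite boxes; the preimage of such
-- a box is a product of a condition on the head and a finite box for the tail.
open Classical in
lemma measurePreserving_consSeq {Y : Type*} [MeasurableSpace Y] (μ : Measure Y)
    [IsProbabilityMeasure μ] :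
    MeasurePreserving consSeq (μ.prod (Measure.infinitePi fun _ : ℕ => μ))
      (Measure.infinitePi fun _ : ℕ => μ) := by
  refine ⟨measurable_consSeq, Measure.eq_infinitePi _ fun s t ht => ?_⟩
  rw [Measure.map_apply measurable_consSeq (.pi s.countable_toSet fun i _ => ht i)]
  have hpre : consSeq ⁻¹' (Set.pi (s : Set ℕ) t)
      = (if 0 ∈ s then t 0 else Set.univ) ×ˢ
        Set.pi ((s.preimage Nat.succ Nat.succ_injective.injOn : Finset ℕ) : Set ℕ)
          (fun i => t (i + 1)) := by
    ext ⟨y, ω⟩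
    simp only [Set.mem_preimage, Set.mem_pi, Finset.mem_coe, Set.mem_prod, Finset.mem_preimage]
    constructor
    · intro h
      refine ⟨?_, fun i hi => h (i + 1) hi⟩
      split_ifs with h0
      · exact h 0 h0
      · trivial
    · rintro ⟨h0, h⟩ i hi
      rcases i with _ | i
      · rw [if_pos hi] at h0; exact h0
      · exact h i hi
  rw [hpre, Measure.prod_prod, Measure.infinitePi_pi _ fun i _ => ht (i + 1)]
  have hprod : ∏ i ∈ s.preimage Nat.succ Nat.succ_injective.injOn, μ (t (i + 1))
      = ∏ i ∈ s.erase 0, μ (t i) := by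
    have := Finset.prod_preimage' Nat.succ s Nat.succ_injective.injOn (fun i => μ (t i))
    refine this.trans (Finset.prod_congr ?_ fun _ _ => rfl)
    ext i
    rcases i with _ | i <;> simp
  rw [hprod]
  split_ifs with h0
  · exact Finset.mul_prod_erase s (fun i => μ (t i)) h0
  · rw [measure_univ, one_mul, Finset.erase_eq_of_notMem h0]

lemma integral_pow_mul_sub_pow (t : ℝ) (i l : ℕ) :
    ∫ s in (0 : ℝ)..t, s ^ i * (t - s) ^ l
      = (i ! : ℝ) * (l ! : ℝ) / ((i + l + 1)! : ℝ) * t ^ (i + l + 1) := by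
  induction l generalizing i with
  | zero =>
    simp only [pow_zero, mul_one, integral_pow, add_zero, Nat.factorial_zero, Nat.factorial_succ]
    have := Nat.factorial_ne_zero i
    push_cast
    field_simp
    simp
  | succ l ih =>
    have h := intervalIntegral.integral_mul_deriv_eq_deriv_mul (a := 0) (b := t)
      (u := fun s => (t - s) ^ (l + 1)) (u' := fun s => -((l + 1 : ℝ) * (t - s) ^ l))
      (v := fun s => s ^ (i + 1) / (i + 1)) (v' := fun s => s ^ i)
      (fun s _ => by
        have := ((hasDerivAt_id s).const_sub t).pow (l + 1)
        convert! this using 1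
        simp)
      (fun s _ => by
        have := ((hasDerivAt_id s).pow (i + 1)).div_const ((i : ℝ) + 1)
        convert! this using 1
        have : (i : ℝ) + 1 ≠ 0 := by positivity
        simp
        field_simp)
      (Continuous.intervalIntegrable (by fun_prop) _ _)
      (Continuous.intervalIntegrable (by fun_prop) _ _)
    have h2 : ∀ s : ℝ, s ^ i * (t - s) ^ (l + 1) = (t - s) ^ (l + 1) * s ^ i := fun s => by ring
    have h3 : ∀ s : ℝ, -((l + 1 : ℝ) * (t - s) ^ l) * (s ^ (i + 1) / (i + 1))
      = -(((l : ℝ) + 1) / (i + 1)) * (s ^ (i + 1) * (t - s) ^ l) := fun s => by ring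
    simp_rw [h2]
    rw [h]
    simp_rw [h3]
    rw [intervalIntegral.integral_const_mul, ih (i + 1), show i + 1 + l + 1 = i + (l + 1) + 1 by ring,
      Nat.factorial_succ i, Nat.factorial_succ l]
    have := Nat.factorial_ne_zero (i + (l + 1) + 1)
    have h4 : (i : ℝ) + 1 ≠ 0 := by positivity
    push_cast
    simp
    field_simp

lemma setIntegral_Ioc_expMeasure {lam t : ℝ} (hlam : 0 < lam) (ht : 0 ≤ t) (F : ℝ → ℝ) :
    ∫ s in Set.Ioc 0 t, F s ∂(ProbabilityTheory.expMeasure lam)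
      = ∫ s in (0 : ℝ)..t, lam * Real.exp (-(lam * s)) * F s := by
  rw [ProbabilityTheory.expMeasure, ProbabilityTheory.gammaMeasure,
    restrict_withDensity measurableSet_Ioc, intervalIntegral.integral_of_le ht]
  have : ProbabilityTheory.gammaPDF 1 lam
      = fun s => ((ProbabilityTheory.gammaPDFReal 1 lam s).toNNReal : ENNReal) := rfl
  rw [this, integral_withDensity_eq_integral_smul
    (ProbabilityTheory.measurable_gammaPDFReal 1 lam).real_toNNReal]
  refine setIntegral_congr_fun measurableSet_Ioc fun s hs => ?_
  rw [NNReal.smul_def, Real.coe_toNNReal _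
    (ProbabilityTheory.gammaPDFReal_nonneg one_pos hlam s), ProbabilityTheory.gammaPDFReal,
    if_pos hs.1.le]
  simp

lemma expMeasure_real_Ioi {lam t : ℝ} (hlam : 0 < lam) (ht : 0 ≤ t) :
    (ProbabilityTheory.expMeasure lam).real (Set.Ioi t) = Real.exp (-(lam * t)) := by
  have := ProbabilityTheory.isProbabilityMeasure_expMeasure hlam
  rw [← Set.compl_Iic, probReal_compl_eq_one_sub measurableSet_Iic,
    ← ProbabilityTheory.cdf_eq_real, ProbabilityTheory.cdf_expMeasure_eq hlam, if_pos ht]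
  ring

/-- The position at time `t` of the particle, computed as if exactly `n` events occurred. -/
def positionAt {m : ℕ} (c t : ℝ) (n : ℕ) (ω : ℕ → ℝ × UnitSphere m) : E m :=
  c • (∑ k ∈ Finset.range n, (ω k).1 • ((ω k).2 : E m)
    + (t - eventTime ω n) • ((ω n).2 : E m))

/-- The event that exactly `n` events occur up to time `t`, the first `n` waiting times being
positive. -/
def countEvent (m : ℕ) (t : ℝ) (n : ℕ) : Set (ℕ → ℝ × UnitSphere m) :=
  {ω | (∀ k < n, 0 < (ω k).1) ∧ eventTime ω n ≤ t ∧ t < eventTime ω (n + 1)}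

lemma measurable_eventTime {m : ℕ} (k : ℕ) :
    Measurable fun ω : ℕ → ℝ × UnitSphere m => eventTime ω k := by
  unfold eventTime
  fun_prop

lemma measurable_positionAt {m : ℕ} (c t : ℝ) (n : ℕ) :
    Measurable (positionAt (m := m) c t n) := by
  unfold positionAt eventTime
  fun_prop

lemma measurableSet_countEvent (m : ℕ) (t : ℝ) (n : ℕ) : MeasurableSet (countEvent m t n) := by
  have h1 : MeasurableSet {ω : ℕ → ℝ × UnitSphere m | ∀ k < n, 0 < (ω k).1} := by
    have : {ω : ℕ → ℝ × UnitSphere m | ∀ k < n, 0 < (ω k).1}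
        = ⋂ k, ⋂ (_ : k < n), {ω | 0 < (ω k).1} := by ext; simp
    rw [this]
    exact MeasurableSet.iInter fun k => MeasurableSet.iInter fun _ =>
      measurableSet_lt measurable_const (by fun_prop)
  exact h1.inter ((measurableSet_le (measurable_eventTime n) measurable_const).inter
    (measurableSet_lt measurable_const (measurable_eventTime (n + 1))))

lemma eventTime_nonneg {m n : ℕ} {ω : ℕ → ℝ × UnitSphere m} (h : ∀ k < n, 0 < (ω k).1) :
    0 ≤ eventTime ω n :=
  Finset.sum_nonneg fun k hk => (h k (Finset.mem_range.1 hk)).le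

lemma countEvent_of_neg {m n : ℕ} {t : ℝ} (ht : t < 0) : countEvent m t n = ∅ := by
  ext ω
  simp only [countEvent, Set.mem_ofPred_eq, Set.mem_empty_iff_false, iff_false]
  rintro ⟨h1, h2, -⟩
  linarith [eventTime_nonneg h1]

/-- The path has total length `c * t`. Since `countEvent` includes positivity of the waiting times,
the bound holds at every point of the event, not just almost surely. -/
lemma norm_positionAt_le {m n : ℕ} {c t : ℝ} (hc : 0 ≤ c) {ω : ℕ → ℝ × UnitSphere m}
    (h : ω ∈ countEvent m t n) : ‖positionAt c t n ω‖ ≤ c * t := by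
  obtain ⟨h1, h2, -⟩ := h
  have hS : ∀ k, ‖((ω k).2 : E m)‖ = 1 := fun k => by simp
  rw [positionAt, norm_smul, Real.norm_of_nonneg hc]
  refine mul_le_mul_of_nonneg_left ?_ hc
  calc _ ≤ ∑ k ∈ Finset.range n, (ω k).1 + (t - eventTime ω n) := by
        refine (norm_add_le _ _).trans (add_le_add ((norm_sum_le _ _).trans
          (Finset.sum_le_sum fun k hk => ?_)) ?_)
        · rw [norm_smul, hS, mul_one, Real.norm_of_nonneg (h1 k (Finset.mem_range.1 hk)).le]
        · rw [norm_smul, hS, mul_one, Real.norm_of_nonneg (by linarith)]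
    _ = t := by rw [eventTime]; ring

lemma eventTime_consSeq {m : ℕ} (p : (ℝ × UnitSphere m) × (ℕ → ℝ × UnitSphere m)) (n : ℕ) :
    eventTime (consSeq p) (n + 1) = p.1.1 + eventTime p.2 n := by
  rw [eventTime, Finset.sum_range_succ', eventTime, add_comm]
  simp

lemma positionAt_consSeq {m : ℕ} (c t : ℝ) (n : ℕ)
    (p : (ℝ × UnitSphere m) × (ℕ → ℝ × UnitSphere m)) :
    positionAt c t (n + 1) (consSeq p)
      = (c * p.1.1) • (p.1.2 : E m) + positionAt c (t - p.1.1) n p.2 := by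
  rw [positionAt, positionAt, eventTime_consSeq, Finset.sum_range_succ']
  simp only [consSeq_succ, consSeq_zero, smul_add, mul_smul]
  rw [sub_add_eq_sub_sub]
  abel

lemma consSeq_mem_countEvent {m : ℕ} (t : ℝ) (n : ℕ)
    (p : (ℝ × UnitSphere m) × (ℕ → ℝ × UnitSphere m)) :
    consSeq p ∈ countEvent m t (n + 1) ↔ 0 < p.1.1 ∧ p.2 ∈ countEvent m (t - p.1.1) n := by
  simp only [countEvent, Set.mem_ofPred_eq, eventTime_consSeq, le_sub_iff_add_le',
    sub_lt_iff_lt_add']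
  constructor
  · rintro ⟨h1, h2, h3⟩
    exact ⟨h1 0 n.succ_pos, fun k hk => h1 (k + 1) (by omega), h2, h3⟩
  · rintro ⟨h0, h1, h2, h3⟩
    refine ⟨fun k hk => ?_, h2, h3⟩
    rcases k with _ | k
    · exact h0
    · exact h1 k (by omega)

lemma isProbabilityMeasure_inputLaw {m : ℕ} [NeZero m] {lam : ℝ} (hlam : 0 < lam) :
    IsProbabilityMeasure (inputLaw m lam) := by
  have := ProbabilityTheory.isProbabilityMeasure_expMeasure hlam
  unfold inputLaw
  infer_instance

/-- The moment of order `l` of `⟪α, X(t)⟫` on the event that exactly `n` events occur. -/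
def flightMoment (lam c : ℝ) (α : E 6) (n l : ℕ) (t : ℝ) : ℝ :=
  ∫ ω in countEvent 6 t n, (inner ℝ α (positionAt c t n ω)) ^ l ∂inputLaw 6 lam

lemma abs_inner_pow_le {α x : E 6} {R : ℝ} (hx : ‖x‖ ≤ R) (l : ℕ) :
    ‖(inner ℝ α x) ^ l‖ ≤ (‖α‖ * R) ^ l := by
  rw [norm_pow]
  exact pow_le_pow_left₀ (norm_nonneg _)
    ((norm_inner_le_norm α x).trans (mul_le_mul_of_nonneg_left hx (norm_nonneg _))) l

lemma measurable_inner_positionAt_pow (c t : ℝ) (α : E 6) (n l : ℕ) :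
    Measurable fun ω => (inner ℝ α (positionAt c t n ω)) ^ l :=
  ((measurable_positionAt c t n).const_inner).pow_const l

lemma integrableOn_inner_positionAt_pow {lam c : ℝ} (hlam : 0 < lam) (hc : 0 ≤ c) (t : ℝ)
    (α : E 6) (n l : ℕ) :
    IntegrableOn (fun ω => (inner ℝ α (positionAt c t n ω)) ^ l) (countEvent 6 t n)
      (inputLaw 6 lam) := by
  have := isProbabilityMeasure_inputLaw (m := 6) hlam
  refine Measure.integrableOn_of_bounded (M := (‖α‖ * (c * t)) ^ l) (measure_ne_top _ _)
    (measurable_inner_positionAt_pow c t α n l).aestronglyMeasurable ?_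
  filter_upwards [ae_restrict_mem (measurableSet_countEvent 6 t n)] with ω hω
  exact abs_inner_pow_le (norm_positionAt_le hc hω) l

lemma flightMoment_of_neg (lam c : ℝ) (α : E 6) (n l : ℕ) {t : ℝ} (ht : t < 0) :
    flightMoment lam c α n l t = 0 := by
  simp [flightMoment, countEvent_of_neg ht]

lemma flightMoment_zero {lam : ℝ} (hlam : 0 < lam) (c : ℝ) (α : E 6) (l : ℕ) {t : ℝ}
    (ht : 0 ≤ t) :
    flightMoment lam c α 0 l t
      = Real.exp (-(lam * t)) * (c * t) ^ l * (‖α‖ ^ l * sphereMoment l) := by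
  have hP := ProbabilityTheory.isProbabilityMeasure_expMeasure hlam
  have hmp : MeasurePreserving (Function.eval 0) (inputLaw 6 lam)
      ((ProbabilityTheory.expMeasure lam).prod (uniformDirection 6)) :=
    measurePreserving_eval_infinitePi _ 0
  have h1 : ∀ ω, (countEvent 6 t 0).indicator
      (fun ω => (inner ℝ α (positionAt c t 0 ω)) ^ l) ω
      = (fun p : ℝ × UnitSphere 6 => (Set.Ioi t).indicator (fun _ => (c * t) ^ l) p.1
          * (inner ℝ α (p.2 : E 6)) ^ l) (Function.eval 0 ω) := by
    intro ω
    have hmem : ω ∈ countEvent 6 t 0 ↔ (ω 0).1 ∈ Set.Ioi t := by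
      simp [countEvent, eventTime, ht]
    by_cases hω : ω ∈ countEvent 6 t 0
    · simp only [Function.eval]
      rw [Set.indicator_of_mem hω, Set.indicator_of_mem (hmem.1 hω), ← mul_pow]
      simp [positionAt, eventTime, inner_smul_right, mul_assoc]
    · simp only [Function.eval]
      rw [Set.indicator_of_notMem hω, Set.indicator_of_notMem (fun h => hω (hmem.2 h)), zero_mul]
  rw [flightMoment, ← integral_indicator (measurableSet_countEvent 6 t 0),
    integral_congr_ae (Eventually.of_forall h1), ← integral_map
      (f := fun p : ℝ × UnitSphere 6 => (Set.Ioi t).indicator (fun _ => (c * t) ^ l) p.1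
          * (inner ℝ α (p.2 : E 6)) ^ l) hmp.measurable.aemeasurable,
    hmp.map_eq, integral_prod_mul (fun s : ℝ => (Set.Ioi t).indicator (fun _ => (c * t) ^ l) s)
      (fun u : UnitSphere 6 => (inner ℝ α (u : E 6)) ^ l), integral_uniformDirection_inner_pow,
    integral_indicator_const _ measurableSet_Ioi, expMeasure_real_Ioi hlam ht, smul_eq_mul]
  refine Measurable.aestronglyMeasurable ?_
  exact ((measurable_const.indicator measurableSet_Ioi).comp measurable_fst).mul
    (((measurable_subtype_coe.comp measurable_snd).const_inner).pow_const l)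

/-- After the first switch at time `s` the flight restarts with `n` events and time `t - s` left.
Fubini and the binomial theorem separate the first step from the rest. No cutoff `s ≤ t` is needed,
because `flightMoment` vanishes at negative times. -/
lemma flightMoment_succ {lam c : ℝ} (hlam : 0 < lam) (hc : 0 ≤ c) (α : E 6) (n l : ℕ) (t : ℝ) :
    flightMoment lam c α (n + 1) l t
      = ∫ p : ℝ × UnitSphere 6, (Set.Ioi (0 : ℝ)).indicator (fun s =>
          ∑ q ∈ Finset.HasAntidiagonal.antidiagonal l, (l.choose q.1 : ℝ) * ((c * s * inner ℝ α (p.2 : E 6)) ^ q.1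
            * flightMoment lam c α n q.2 (t - s))) p.1
          ∂(ProbabilityTheory.expMeasure lam).prod (uniformDirection 6) := by
  have hP := ProbabilityTheory.isProbabilityMeasure_expMeasure hlam
  have hI := isProbabilityMeasure_inputLaw (m := 6) hlam
  have hmp : MeasurePreserving consSeq
      (((ProbabilityTheory.expMeasure lam).prod (uniformDirection 6)).prod (inputLaw 6 lam))
      (inputLaw 6 lam) := measurePreserving_consSeq _
  have hmeas : Measurable ((countEvent 6 t (n + 1)).indicator
      (fun ω => (inner ℝ α (positionAt c t (n + 1) ω)) ^ l)) :=
    (measurable_inner_positionAt_pow c t α (n + 1) l).indicator (measurableSet_countEvent 6 t _)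
  have hint : Integrable ((countEvent 6 t (n + 1)).indicator
      (fun ω => (inner ℝ α (positionAt c t (n + 1) ω)) ^ l)) (inputLaw 6 lam) :=
    (integrableOn_inner_positionAt_pow hlam hc t α (n + 1) l).integrable_indicator
      (measurableSet_countEvent 6 t _)
  rw [flightMoment, ← integral_indicator (measurableSet_countEvent 6 t _)]
  conv_lhs => rw [← hmp.map_eq]
  rw [integral_map hmp.measurable.aemeasurable hmeas.aestronglyMeasurable, integral_prod]
  swap
  · exact (hmp.integrable_comp hmeas.aestronglyMeasurable).2 hint
  refine integral_congr_ae (Eventually.of_forall fun p => ?_)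
  simp only
  by_cases hs : p.1 ∈ Set.Ioi (0 : ℝ)
  · rw [Set.indicator_of_mem hs]
    have h1 : ∀ ω, (countEvent 6 t (n + 1)).indicator
        (fun ω => (inner ℝ α (positionAt c t (n + 1) ω)) ^ l) (consSeq (p, ω))
        = (countEvent 6 (t - p.1) n).indicator (fun ω => ∑ q ∈ Finset.HasAntidiagonal.antidiagonal l,
          (l.choose q.1 : ℝ) * ((c * p.1 * inner ℝ α (p.2 : E 6)) ^ q.1
            * (inner ℝ α (positionAt c (t - p.1) n ω)) ^ q.2)) ω := by
      intro ω
      have hmem := consSeq_mem_countEvent t n (p, ω)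
      by_cases hω : ω ∈ countEvent 6 (t - p.1) n
      · rw [Set.indicator_of_mem hω, Set.indicator_of_mem (hmem.2 ⟨hs, hω⟩), positionAt_consSeq,
          inner_add_right, inner_smul_right, (Commute.all _ _).add_pow']
        simp [nsmul_eq_mul]
      · rw [Set.indicator_of_notMem hω, Set.indicator_of_notMem fun h => hω (hmem.1 h).2]
    rw [integral_congr_ae (Eventually.of_forall h1),
      integral_indicator (measurableSet_countEvent 6 _ n), integral_finsetSum]
    · refine Finset.sum_congr rfl fun q _ => ?_
      rw [integral_const_mul, integral_const_mul, flightMoment]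
    · intro q _
      exact ((integrableOn_inner_positionAt_pow hlam hc _ α n q.2).const_mul _).const_mul _
  · rw [Set.indicator_of_notMem hs]
    have h1 : ∀ ω, (countEvent 6 t (n + 1)).indicator
        (fun ω => (inner ℝ α (positionAt c t (n + 1) ω)) ^ l) (consSeq (p, ω)) = 0 := fun ω =>
      Set.indicator_of_notMem (fun h => hs ((consSeq_mem_countEvent t n (p, ω)).1 h).1) _
    simp [h1]

open PowerSeries in
/-- The moments of the flight, restricted to the event that exactly `n` events occur. -/
theorem flightMoment_eq {lam c : ℝ} (hlam : 0 < lam) (hc : 0 ≤ c) (α : E 6) (n l : ℕ) {t : ℝ}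
    (ht : 0 ≤ t) :
    flightMoment lam c α n l t
      = Real.exp (-(lam * t)) * (lam * t) ^ n * ((c * t) ^ l * ‖α‖ ^ l
        * ((l ! : ℝ) / ((l + n)! : ℝ) * coeff l (momentSeries ^ (n + 1)))) := by
  have hP := ProbabilityTheory.isProbabilityMeasure_expMeasure hlam
  induction n generalizing l t with
  | zero =>
    have := Nat.factorial_ne_zero l
    rw [flightMoment_zero hlam c α l ht]
    simp only [zero_add, pow_one, momentSeries, coeff_mk, add_zero, pow_zero]
    field_simp
  | succ n ih =>
    rw [flightMoment_succ hlam hc]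
    have key : ∀ p : ℝ × UnitSphere 6, (Set.Ioi (0 : ℝ)).indicator (fun s =>
          ∑ q ∈ Finset.HasAntidiagonal.antidiagonal l, (l.choose q.1 : ℝ) * ((c * s * inner ℝ α (p.2 : E 6)) ^ q.1
            * flightMoment lam c α n q.2 (t - s))) p.1
        = ∑ q ∈ Finset.HasAntidiagonal.antidiagonal l,
          (l.choose q.1 : ℝ) * (c ^ l * ‖α‖ ^ q.2 * lam ^ n * ((q.2 ! : ℝ) / ((q.2 + n)! : ℝ)
            * coeff q.2 (momentSeries ^ (n + 1)))) *
          ((Set.Ioc 0 t).indicator (fun s => Real.exp (-(lam * (t - s)))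
              * (s ^ q.1 * (t - s) ^ (q.2 + n))) p.1
            * (inner ℝ α (p.2 : E 6)) ^ q.1) := by
      rintro ⟨s, u⟩
      simp only
      by_cases h0 : 0 < s
      · rw [Set.indicator_of_mem (Set.mem_Ioi.2 h0)]
        refine Finset.sum_congr rfl fun q hq => ?_
        have hq : q.1 + q.2 = l := Finset.HasAntidiagonal.mem_antidiagonal.1 hq
        by_cases hst : s ≤ t
        · rw [Set.indicator_of_mem (Set.mem_Ioc.2 ⟨h0, hst⟩), ih _ (sub_nonneg.2 hst), ← hq,
            mul_pow lam, mul_pow c (t - s)]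
          ring
        · rw [Set.indicator_of_notMem fun h => hst h.2, flightMoment_of_neg _ _ _ _ _ (by linarith)]
          ring
      · rw [Set.indicator_of_notMem fun h : s ∈ Set.Ioi 0 => h0 h]
        refine (Finset.sum_eq_zero fun q _ => ?_).symm
        rw [Set.indicator_of_notMem fun h => h0 h.1]
        ring
    have hint : ∀ q : ℕ × ℕ, Integrable (fun p : ℝ × UnitSphere 6 =>
        (Set.Ioc 0 t).indicator (fun s => Real.exp (-(lam * (t - s)))
              * (s ^ q.1 * (t - s) ^ (q.2 + n))) p.1 * (inner ℝ α (p.2 : E 6)) ^ q.1)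
        ((ProbabilityTheory.expMeasure lam).prod (uniformDirection 6)) := by
      intro q
      refine Integrable.mul_prod (f := (Set.Ioc 0 t).indicator (fun s => Real.exp (-(lam * (t - s)))
              * (s ^ q.1 * (t - s) ^ (q.2 + n))))
        (g := fun u : UnitSphere 6 => (inner ℝ α (u : E 6)) ^ q.1) ?_ ?_
      · rw [integrable_indicator_iff measurableSet_Ioc]
        have : ContinuousOn (fun s => Real.exp (-(lam * (t - s)))
              * (s ^ q.1 * (t - s) ^ (q.2 + n))) (Set.Icc 0 t) := by fun_prop
        exact (this.integrableOn_compact isCompact_Icc).mono_set Set.Ioc_subset_Icc_self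
      · refine Integrable.of_bound (C := (‖α‖ * 1) ^ q.1)
          (Measurable.aestronglyMeasurable
            ((measurable_subtype_coe.const_inner).pow_const _)) (Eventually.of_forall fun u => ?_)
        exact abs_inner_pow_le (by simp) _
    rw [integral_congr_ae (Eventually.of_forall key), integral_finsetSum]
    swap
    · exact fun q _ => (hint q).const_mul _
    have hval : ∀ q ∈ Finset.HasAntidiagonal.antidiagonal l, ∫ p : ℝ × UnitSphere 6,
          (l.choose q.1 : ℝ) * (c ^ l * ‖α‖ ^ q.2 * lam ^ n * ((q.2 ! : ℝ) / ((q.2 + n)! : ℝ)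
            * coeff q.2 (momentSeries ^ (n + 1)))) *
          ((Set.Ioc 0 t).indicator (fun s => Real.exp (-(lam * (t - s)))
              * (s ^ q.1 * (t - s) ^ (q.2 + n))) p.1
            * (inner ℝ α (p.2 : E 6)) ^ q.1)
          ∂(ProbabilityTheory.expMeasure lam).prod (uniformDirection 6)
        = Real.exp (-(lam * t)) * (lam * t) ^ (n + 1) * ((c * t) ^ l * ‖α‖ ^ l
          * ((l ! : ℝ) / ((l + (n + 1))! : ℝ)))
          * (coeff q.1 momentSeries * coeff q.2 (momentSeries ^ (n + 1))) := by
      intro q hq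
      have hq : q.1 + q.2 = l := Finset.HasAntidiagonal.mem_antidiagonal.1 hq
      -- The density of the first waiting time and the survival factor of the remainder multiply to
      -- `e^{-lam t}`, which does not depend on `s`; a pure Beta integral remains.
      have hexp : ∀ s : ℝ, lam * Real.exp (-(lam * s)) * (Real.exp (-(lam * (t - s)))
              * (s ^ q.1 * (t - s) ^ (q.2 + n)))
          = lam * Real.exp (-(lam * t)) * (s ^ q.1 * (t - s) ^ (q.2 + n)) := by
        intro s
        rw [show -(lam * t) = -(lam * s) + -(lam * (t - s)) by ring, Real.exp_add]
        ring
      rw [integral_const_mul, integral_prod_mul (fun s => (Set.Ioc 0 t).indicator (fun s =>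
          Real.exp (-(lam * (t - s))) * (s ^ q.1 * (t - s) ^ (q.2 + n))) s)
          (fun u : UnitSphere 6 => (inner ℝ α (u : E 6)) ^ q.1),
        integral_uniformDirection_inner_pow, integral_indicator measurableSet_Ioc,
        setIntegral_Ioc_expMeasure hlam ht]
      simp_rw [hexp]
      -- The Beta integral gives `q.1! (q.2 + n)! / (l + n + 1)!`. Together with the binomial
      -- coefficient and `q.2! / (q.2 + n)!` from the induction hypothesis this leaves `l! / (l + n
      -- + 1)!`, independent of `q`, so the sum over `q` is a Cauchy product.
      rw [intervalIntegral.integral_const_mul, integral_pow_mul_sub_pow, ← hq,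
        Nat.cast_choose ℝ (Nat.le_add_right q.1 q.2), Nat.add_sub_cancel_left,
        momentSeries, coeff_mk, show q.1 + (q.2 + n) + 1 = q.1 + q.2 + (n + 1) by ring]
      have h1 := Nat.factorial_ne_zero q.1
      have h2 := Nat.factorial_ne_zero q.2
      have h3 := Nat.factorial_ne_zero (q.2 + n)
      field_simp
      ring
    rw [Finset.sum_congr rfl hval, ← Finset.mul_sum, pow_succ' momentSeries (n + 1), coeff_mul]
    ring

/-! ### Measures of bounded support and their moments -/

lemma hasSum_charFun_of_norm_le {m : ℕ} {μ : Measure (E m)} [IsFiniteMeasure μ] {R : ℝ}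
    (hμ : ∀ᵐ x ∂μ, ‖x‖ ≤ R) (α : E m) :
    HasSum (fun l : ℕ => (Complex.I ^ l / (l ! : ℂ)) * ((∫ x, (inner ℝ α x) ^ l ∂μ : ℝ) : ℂ))
      (charFun μ α) := by
  -- `R` may be negative (then the measure is zero), whereas the dominating terms need a nonnegative
  -- bound.
  have hR : ∀ᵐ x ∂μ, ‖x‖ ≤ |R| := hμ.mono fun x hx => hx.trans (le_abs_self R)
  have h := hasSum_integral_of_dominated_convergence (μ := μ)
    (F := fun (l : ℕ) x => (((inner ℝ x α : ℝ) : ℂ) * Complex.I) ^ l / (l ! : ℂ))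
    (f := fun x => Complex.exp (((inner ℝ x α : ℝ) : ℂ) * Complex.I))
    (fun l _ => (‖α‖ * |R|) ^ l / (l ! : ℝ))
    (fun l => by
      refine Measurable.aestronglyMeasurable ?_
      fun_prop)
    (fun l => by
      filter_upwards [hR] with x hx
      rw [norm_div, norm_pow, norm_mul, Complex.norm_I, mul_one, Complex.norm_real,
        Complex.norm_natCast]
      gcongr
      calc ‖inner ℝ x α‖ ≤ ‖x‖ * ‖α‖ := norm_inner_le_norm x α
        _ ≤ ‖α‖ * |R| := by rw [mul_comm]; gcongr)
    (Eventually.of_forall fun _ => Real.summable_pow_div_factorial _)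
    (integrable_const _)
    (Eventually.of_forall fun x => by
      rw [Complex.exp_eq_exp_ℂ]
      exact NormedSpace.expSeries_div_hasSum_exp _)
  rw [charFun_apply]
  convert! h using 2 with l
  rw [← integral_complex_ofReal, ← integral_const_mul]
  congr 1
  funext x
  rw [real_inner_comm, mul_pow]
  push_cast
  ring

/-- Finite measures of bounded support are determined by their moments. -/
lemma ext_of_integral_inner_pow {m : ℕ} {μ ν : Measure (E m)} [IsFiniteMeasure μ]
    [IsFiniteMeasure ν] {R : ℝ} (hμ : ∀ᵐ x ∂μ, ‖x‖ ≤ R) (hν : ∀ᵐ x ∂ν, ‖x‖ ≤ R)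
    (h : ∀ (α : E m) (l : ℕ), ∫ x, (inner ℝ α x) ^ l ∂μ = ∫ x, (inner ℝ α x) ^ l ∂ν) :
    μ = ν := by
  refine Measure.ext_of_charFun (funext fun α => ?_)
  refine (hasSum_charFun_of_norm_le hμ α).unique ?_
  simp_rw [h]
  exact hasSum_charFun_of_norm_le hν α

lemma ae_norm_le_withDensity {m : ℕ} {h : E m → ℝ} {R : ℝ}
    (h0 : ∀ x, R < ‖x‖ → h x = 0) (hm : Measurable h) :
    ∀ᵐ x ∂(volume.withDensity fun x => ENNReal.ofReal (h x)), ‖x‖ ≤ R := by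
  rw [ae_withDensity_iff (by fun_prop)]
  refine Eventually.of_forall fun x hx => ?_
  by_contra hR
  exact hx (by simp [h0 x (not_le.1 hR)])

lemma integral_withDensity_ofReal {X : Type*} [MeasurableSpace X] {μ : Measure X} {h : X → ℝ}
    (hm : Measurable h) (f : X → ℝ) :
    ∫ x, f x ∂(μ.withDensity fun x => ENNReal.ofReal (h x)) = ∫ x, f x * max (h x) 0 ∂μ := by
  simp only [ENNReal.ofReal]
  rw [integral_withDensity_eq_integral_smul hm.real_toNNReal]
  refine integral_congr_ae (Eventually.of_forall fun x => ?_)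
  simp only [NNReal.smul_def, Real.coe_toNNReal', smul_eq_mul]
  ring

/-- A finite measure of bounded support whose moments agree with those of a signed density has
that density, which is then nonnegative. -/
lemma eq_withDensity_of_integral_inner_pow {m : ℕ} {μ : Measure (E m)} [IsFiniteMeasure μ] {R : ℝ}
    (hμ : ∀ᵐ x ∂μ, ‖x‖ ≤ R) {h : E m → ℝ} (hm : Measurable h) (h0 : ∀ x, R < ‖x‖ → h x = 0)
    (hi : ∀ (α : E m) (l : ℕ), Integrable fun x => (inner ℝ α x) ^ l * h x)
    (heq : ∀ (α : E m) (l : ℕ), ∫ x, (inner ℝ α x) ^ l ∂μ = ∫ x, (inner ℝ α x) ^ l * h x) :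
    (∀ᵐ x, 0 ≤ h x) ∧ μ = volume.withDensity fun x => ENNReal.ofReal (h x) := by
  have hint : Integrable h := by simpa using hi 0 0
  -- The signed density is split into its positive part `P` and negative part `N`. Moment uniqueness
  -- is applied to the genuine measures `μ + N` and `P`.
  set P : Measure (E m) := volume.withDensity fun x => ENNReal.ofReal (h x) with hP
  set N : Measure (E m) := volume.withDensity fun x => ENNReal.ofReal (-h x) with hN
  have : IsFiniteMeasure P := isFiniteMeasure_withDensity_ofReal hint.2
  have : IsFiniteMeasure N := isFiniteMeasure_withDensity_ofReal hint.neg.2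
  have hPR : ∀ᵐ x ∂P, ‖x‖ ≤ R := ae_norm_le_withDensity h0 hm
  have hNR : ∀ᵐ x ∂N, ‖x‖ ≤ R :=
    ae_norm_le_withDensity (h := fun x => -h x) (fun x hx => by simp [h0 x hx]) hm.neg
  have hbdd : ∀ (ν : Measure (E m)) [IsFiniteMeasure ν], (∀ᵐ x ∂ν, ‖x‖ ≤ R) →
      ∀ (α : E m) (l : ℕ), Integrable (fun x => (inner ℝ α x) ^ l) ν := by
    intro ν _ hν α l
    refine Integrable.of_bound (C := (‖α‖ * R) ^ l)
      (Measurable.aestronglyMeasurable (by fun_prop)) ?_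
    filter_upwards [hν] with x hx
    rw [norm_pow]
    exact pow_le_pow_left₀ (norm_nonneg _)
      ((norm_inner_le_norm α x).trans (mul_le_mul_of_nonneg_left hx (norm_nonneg _))) l
  have hsum : μ + N = P := by
    refine ext_of_integral_inner_pow (R := R) ?_ hPR fun α l => ?_
    · rw [ae_add_measure_iff]
      exact ⟨hμ, hNR⟩
    · rw [integral_add_measure (hbdd μ hμ α l) (hbdd N hNR α l), heq, hN, hP,
        integral_withDensity_ofReal (h := fun x => -h x) hm.neg, integral_withDensity_ofReal hm, ← integral_add]
      · refine integral_congr_ae (Eventually.of_forall fun x => ?_)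
        simp only [← mul_add]
        congr 1
        rcases le_total 0 (h x) with hx | hx
        · rw [max_eq_right (by linarith), max_eq_left hx, add_zero]
        · rw [max_eq_left (by linarith), max_eq_right hx, add_neg_cancel]
      · exact hi α l
      · refine (hi α l).mono (Measurable.aestronglyMeasurable (by fun_prop))
          (Eventually.of_forall fun x => ?_)
        rw [norm_mul, norm_mul]
        refine mul_le_mul_of_nonneg_left ?_ (norm_nonneg _)
        rw [Real.norm_eq_abs, abs_of_nonneg (le_max_right _ _), Real.norm_eq_abs]
        exact max_le (neg_le_abs _) (abs_nonneg _)
  have hB : MeasurableSet {x | h x < 0} := measurableSet_lt hm measurable_const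
  -- The set where the density is negative is null for `P = μ + N`, hence for `N`, which is
  -- concentrated there; so `N` vanishes.
  have hPB : P {x | h x < 0} = 0 := by
    rw [hP, withDensity_apply _ hB, setLIntegral_congr_fun hB
      (g := fun _ => 0) fun x hx => ENNReal.ofReal_of_nonpos (le_of_lt hx)]
    simp
  have hNB : N {x | h x < 0} = 0 := by
    have := congrArg (fun ν : Measure (E m) => ν {x | h x < 0}) hsum
    simp only [Measure.add_apply, hPB, add_eq_zero] at this
    exact this.2
  have hnn : ∀ᵐ x, 0 ≤ h x := by
    rw [hN, withDensity_apply_eq_zero (by fun_prop)] at hNB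
    rw [ae_iff]
    refine measure_mono_null (fun x hx => ?_) hNB
    have hx : h x < 0 := not_le.1 hx
    exact ⟨by simpa using hx, hx⟩
  refine ⟨hnn, ?_⟩
  have hN0 : N = 0 := by
    rw [hN, withDensity_eq_zero_iff (by fun_prop)]
    filter_upwards [hnn] with x hx
    simpa using hx
  rw [← hsum, hN0, add_zero]

/-! ### Convergence and continuity of the double series -/

lemma abs_hypCoeff_le (N k i : ℕ) : |hypCoeff N k i| ≤ (N.choose i : ℝ) * 2 ^ (i + k + 2) := by
  have h1 : ((i + k + 2)! : ℝ) = ((i + k + 2).choose k : ℝ) * (k ! : ℝ) * ((i + 2)! : ℝ) := by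
    have := Nat.choose_mul_factorial_mul_factorial (n := i + k + 2) (k := k) (by omega)
    rw [show i + k + 2 - k = i + 2 by omega] at this
    exact_mod_cast this.symm
  have h2 : ((i + k + 2).choose k : ℝ) ≤ 2 ^ (i + k + 2) := by
    exact_mod_cast Nat.choose_le_two_pow _ _
  have h3 : 2 * (k ! : ℝ) ≤ ((k + 2)! : ℝ) := by
    have : 2 * k ! ≤ (k + 2)! := by
      rw [Nat.factorial_succ, Nat.factorial_succ]
      nlinarith [Nat.factorial_pos k, Nat.zero_le (k * k * k !), Nat.zero_le (k * k !)]
    exact_mod_cast this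
  have h4 : (0 : ℝ) < ((k + 2)! : ℝ) := by exact_mod_cast Nat.factorial_pos _
  have h5 : (0 : ℝ) < ((i + 2)! : ℝ) := by exact_mod_cast Nat.factorial_pos _
  rw [hypCoeff, abs_mul, abs_mul, abs_pow, abs_neg, abs_one, one_pow, one_mul, Nat.abs_cast,
    abs_of_nonneg (by positivity)]
  refine mul_le_mul_of_nonneg_left ?_ (Nat.cast_nonneg _)
  rw [div_le_iff₀ (by positivity), h1]
  calc 2 * (((i + k + 2).choose k : ℝ) * (k ! : ℝ) * ((i + 2)! : ℝ))
      = ((i + k + 2).choose k : ℝ) * (2 * (k ! : ℝ)) * ((i + 2)! : ℝ) := by ring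
    _ ≤ 2 ^ (i + k + 2) * ((k + 2)! : ℝ) * ((i + 2)! : ℝ) := by gcongr
    _ = _ := by ring

/-- The coefficient bounds add up by the binomial theorem, `(2 + 1) ^ N`. -/
lemma abs_sum_hypCoeff_le (N k : ℕ) {z : ℝ} (hz : |z| ≤ 1) :
    |∑ i ∈ Finset.range (N + 1), hypCoeff N k i * z ^ i| ≤ 2 ^ (k + 2) * 3 ^ N := by
  calc |∑ i ∈ Finset.range (N + 1), hypCoeff N k i * z ^ i|
      ≤ ∑ i ∈ Finset.range (N + 1), |hypCoeff N k i * z ^ i| := Finset.abs_sum_le_sum_abs _ _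
    _ ≤ ∑ i ∈ Finset.range (N + 1), 2 ^ (k + 2) * (2 ^ i * 1 ^ (N - i) * (N.choose i : ℝ)) := by
        refine Finset.sum_le_sum fun i _ => ?_
        rw [abs_mul, abs_pow]
        calc |hypCoeff N k i| * |z| ^ i ≤ ((N.choose i : ℝ) * 2 ^ (i + k + 2)) * 1 :=
              mul_le_mul (abs_hypCoeff_le N k i) (pow_le_one₀ (abs_nonneg z) hz) (by positivity)
                (by positivity)
          _ = _ := by rw [one_pow, add_assoc, pow_add]; ring
    _ = 2 ^ (k + 2) * 3 ^ N := by
        rw [← Finset.mul_sum, ← add_pow]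
        norm_num

lemma innerCoeff_nonneg (n k : ℕ) : 0 ≤ innerCoeff n k := by
  rw [innerCoeff]
  positivity

/-- The decay comes from `k! / (n + k)! ≤ 1 / n!`. The powers `3 ^ k` cancel, and the other factors
are at most exponential in `n` because `k ≤ n + 3`. Hence the outer series is dominated by an
exponential series, uniformly for `|z| ≤ 1`. -/
lemma innerCoeff_le (n k : ℕ) (hk : k ≤ n + 3) :
    innerCoeff (n + 2) k * (2 ^ (k + 2) * 3 ^ (n + k)) ≤ 2 ^ (7 * n + 24) * 3 ^ n / (n ! : ℝ) := by
  have h1 : ((n + 3)! : ℝ) = ((n + 3).choose k : ℝ) * (k ! : ℝ) * ((n + 3 - k)! : ℝ) := by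
    exact_mod_cast (Nat.choose_mul_factorial_mul_factorial hk).symm
  have h2 : ((n + 3).choose k : ℝ) ≤ 2 ^ (n + 3) := by
    exact_mod_cast Nat.choose_le_two_pow _ _
  have h3 : (n ! : ℝ) * (k ! : ℝ) ≤ ((n + k)! : ℝ) := by
    exact_mod_cast Nat.le_of_dvd (Nat.factorial_pos _)
      (Nat.factorial_mul_factorial_dvd_factorial_add n k)
  have h4 : ((k : ℝ) + 1) ≤ 2 ^ k := by exact_mod_cast Nat.lt_two_pow_self (n := k)
  have h5 : ((k : ℝ) + 2) ≤ 2 ^ (k + 1) := by exact_mod_cast Nat.lt_two_pow_self (n := k + 1)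
  have h6 : ((n : ℝ) + 2 + 2 * k + 1) ≤ 2 ^ (n + 2 * k + 3) := by
    have : n + 2 * k + 3 ≤ 2 ^ (n + 2 * k + 3) := (Nat.lt_two_pow_self (n := n + 2 * k + 3)).le
    calc ((n : ℝ) + 2 + 2 * k + 1) = ((n + 2 * k + 3 : ℕ) : ℝ) := by push_cast; ring
      _ ≤ _ := by exact_mod_cast this
  have p1 : (0 : ℝ) < (n ! : ℝ) := by exact_mod_cast Nat.factorial_pos _
  have p2 : (0 : ℝ) < ((n + k)! : ℝ) := by exact_mod_cast Nat.factorial_pos _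
  have p3 : (0 : ℝ) < ((n + 3 - k)! : ℝ) := by exact_mod_cast Nat.factorial_pos _
  have p4 : (0 : ℝ) < (k ! : ℝ) := by exact_mod_cast Nat.factorial_pos _
  rw [innerCoeff, show n + 2 + 1 = n + 3 by ring, show n + 2 + k - 2 = n + k by omega, h1]
  push_cast
  calc _ = ((n + 3).choose k : ℝ) * (((k : ℝ) + 1) * ((k : ℝ) + 2) * ((n : ℝ) + 2 + 2 * k + 1))
            * (2 ^ (k + 2) * 3 ^ n) * ((k ! : ℝ) / ((n + k)! : ℝ)) := by
        rw [pow_add (3 : ℝ)]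
        field_simp
    _ ≤ 2 ^ (n + 3) * (2 ^ k * 2 ^ (k + 1) * 2 ^ (n + 2 * k + 3)) * (2 ^ (k + 2) * 3 ^ n)
          * (1 / (n ! : ℝ)) := by
        gcongr ?_ * (?_ * ?_ * ?_) * _ * ?_
        rw [div_le_div_iff₀ p2 p1]
        linarith
    _ = 2 ^ (2 * n + 5 * k + 9) * 3 ^ n / (n ! : ℝ) := by
        rw [show 2 * n + 5 * k + 9 = (n + 3) + (k + (k + 1) + (n + 2 * k + 3)) + (k + 2) by ring]
        simp only [pow_add (2 : ℝ)]
        ring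
    _ ≤ _ := by
        gcongr ?_ * _ / _
        exact pow_le_pow_right₀ one_le_two (by omega)

lemma abs_seriesTerm_le (a : ℝ) {z : ℝ} (hz : |z| ≤ 1) (n : ℕ) :
    |seriesTerm a z (n + 2)| ≤ |a| ^ 2 * 2 ^ 28 * ((768 * |a|) ^ n / (n ! : ℝ)) := by
  rw [seriesTerm_eq a z (n + 2) (by omega), abs_mul, abs_pow]
  have h : |∑ k ∈ Finset.range (n + 2 + 2), innerCoeff (n + 2) k *
      ∑ i ∈ Finset.range (n + 2 + k - 2 + 1), hypCoeff (n + 2 + k - 2) k i * z ^ i|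
      ≤ 2 ^ (n + 4) * (2 ^ (7 * n + 24) * 3 ^ n / (n ! : ℝ)) := by
    calc _ ≤ ∑ k ∈ Finset.range (n + 2 + 2), |innerCoeff (n + 2) k *
          ∑ i ∈ Finset.range (n + 2 + k - 2 + 1), hypCoeff (n + 2 + k - 2) k i * z ^ i| :=
          Finset.abs_sum_le_sum_abs _ _
      _ ≤ ∑ k ∈ Finset.range (n + 4), 2 ^ (7 * n + 24) * 3 ^ n / (n ! : ℝ) := by
          refine Finset.sum_le_sum fun k hk => ?_
          have hk : k ≤ n + 3 := by have := Finset.mem_range.1 hk; omega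
          rw [abs_mul, abs_of_nonneg (innerCoeff_nonneg _ _)]
          refine (mul_le_mul_of_nonneg_left (abs_sum_hypCoeff_le _ _ hz)
            (innerCoeff_nonneg _ _)).trans ?_
          rw [show n + 2 + k - 2 = n + k by omega]
          exact innerCoeff_le n k hk
      _ ≤ _ := by
          rw [Finset.sum_const, Finset.card_range, nsmul_eq_mul]
          gcongr
          exact_mod_cast (Nat.lt_two_pow_self (n := n + 4)).le
  refine (mul_le_mul_of_nonneg_left h (by positivity)).trans (le_of_eq ?_)
  rw [show (768 : ℝ) = 2 * 2 ^ 7 * 3 by norm_num, mul_pow, mul_pow, mul_pow, ← pow_mul]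
  simp only [pow_add]
  ring

lemma continuous_seriesTerm (n : ℕ) :
    Continuous fun p : ℝ × ℝ => seriesTerm p.1 p.2 (n + 2) := by
  simp_rw [seriesTerm_eq _ _ (n + 2) (by omega)]
  fun_prop

lemma summable_seriesTerm (a : ℝ) {z : ℝ} (hz : |z| ≤ 1) :
    Summable fun n : ℕ => seriesTerm a z (n + 2) :=
  Summable.of_norm_bounded ((Real.summable_pow_div_factorial _).mul_left _)
    fun n => abs_seriesTerm_le a hz n

/-- The absolutely continuous part of the stationary density, up to the factor
`e^{-a} / (π³ ρ⁶)`, as a function of `a` and `z = ‖x‖² / ρ²`. -/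
def radialAc (a z : ℝ) : ℝ :=
  16 * a * (1 - 5 / 6 * z) + 1 / 2 * ∑' n : ℕ, seriesTerm a z (n + 2)

lemma stationaryAc_eq (a ρ : ℝ) (x : E 6) :
    stationaryAc a ρ x = if ‖x‖ < ρ then
      Real.exp (-a) / (Real.pi ^ 3 * ρ ^ 6) * radialAc a (‖x‖ ^ 2 / ρ ^ 2) else 0 := by
  rw [stationaryAc, radialAc]
  split_ifs
  · ring
  · rfl

lemma seriesTerm_bound_mono {A a : ℝ} (ha : |a| ≤ A) {z : ℝ} (hz : |z| ≤ 1) (n : ℕ) :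
    ‖seriesTerm a z (n + 2)‖ ≤ A ^ 2 * 2 ^ 28 * ((768 * A) ^ n / (n ! : ℝ)) := by
  refine (abs_seriesTerm_le a hz n).trans ?_
  gcongr

/-- Weierstrass test on a neighbourhood. Joint continuity is needed because `a` and `ρ` both vary in
the limit. -/
lemma continuousAt_radialAc (a : ℝ) {z : ℝ} (hz : |z| < 1) :
    ContinuousAt (fun p : ℝ × ℝ => radialAc p.1 p.2) (a, z) := by
  set S : Set (ℝ × ℝ) := {p | |p.1| < |a| + 1} ∩ {p | |p.2| < 1} with hS
  have hSo : IsOpen S :=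
    (isOpen_lt (by fun_prop) continuous_const).inter (isOpen_lt (by fun_prop) continuous_const)
  have hmem : (a, z) ∈ S := ⟨by simp, hz⟩
  have hts : ContinuousOn (fun p : ℝ × ℝ => ∑' n : ℕ, seriesTerm p.1 p.2 (n + 2)) S :=
    continuousOn_tsum (fun n => (continuous_seriesTerm n).continuousOn)
      ((Real.summable_pow_div_factorial (768 * (|a| + 1))).mul_left _)
      fun n p hp => seriesTerm_bound_mono (le_of_lt hp.1) (le_of_lt hp.2) n
  have := hts.continuousAt (hSo.mem_nhds hmem)
  unfold radialAc
  fun_prop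

lemma exists_radialAc_bound (A : ℝ) :
    ∃ K, 0 ≤ K ∧ ∀ a z : ℝ, |a| ≤ A → |z| ≤ 1 → |radialAc a z| ≤ K := by
  have hsum := (Real.summable_pow_div_factorial (768 * A)).mul_left (A ^ 2 * 2 ^ 28)
  refine ⟨|32 * A + 1 / 2 * ∑' n : ℕ, A ^ 2 * 2 ^ 28 * ((768 * A) ^ n / (n ! : ℝ))|, abs_nonneg _,
    fun a z ha hz => le_trans ?_ (le_abs_self _)⟩
  rw [radialAc]
  refine (abs_add_le _ _).trans (add_le_add ?_ ?_)
  · rw [abs_mul, abs_mul, abs_of_pos (by norm_num : (0 : ℝ) < 16)]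
    have h1 : |1 - 5 / 6 * z| ≤ 2 := by
      rw [abs_le] at hz ⊢
      constructor <;> linarith [hz.1, hz.2]
    nlinarith [abs_nonneg a, abs_nonneg (1 - 5 / 6 * z)]
  · rw [abs_mul, abs_of_pos (by norm_num : (0 : ℝ) < 1 / 2)]
    refine mul_le_mul_of_nonneg_left ?_ (by norm_num)
    exact tsum_of_norm_bounded hsum.hasSum fun n => seriesTerm_bound_mono ha hz n

lemma radial_mem {ρ : ℝ} {x : E 6} (hx : ‖x‖ < ρ) : |‖x‖ ^ 2 / ρ ^ 2| < 1 := by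
  have hρ : 0 < ρ := (norm_nonneg x).trans_lt hx
  rw [abs_of_nonneg (by positivity), div_lt_one (by positivity)]
  gcongr

lemma continuousOn_stationaryAc (a ρ : ℝ) :
    ContinuousOn (stationaryAc a ρ) (Metric.ball 0 ρ) := by
  have h : ContinuousOn (fun x : E 6 =>
      Real.exp (-a) / (Real.pi ^ 3 * ρ ^ 6) * radialAc a (‖x‖ ^ 2 / ρ ^ 2)) (Metric.ball 0 ρ) := by
    refine continuousOn_const.mul fun x hx => ContinuousAt.continuousWithinAt ?_
    exact ContinuousAt.comp (g := fun p : ℝ × ℝ => radialAc p.1 p.2)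
      (f := fun x : E 6 => (a, ‖x‖ ^ 2 / ρ ^ 2))
      (continuousAt_radialAc a (radial_mem (mem_ball_zero_iff.1 hx))) (by fun_prop)
  refine h.congr fun x hx => ?_
  rw [stationaryAc_eq, if_pos (mem_ball_zero_iff.1 hx)]

lemma measurable_stationaryAc (a ρ : ℝ) : Measurable (stationaryAc a ρ) := by
  have h : stationaryAc a ρ = (Metric.ball (0 : E 6) ρ).indicator (stationaryAc a ρ) := by
    funext x
    by_cases hx : x ∈ Metric.ball (0 : E 6) ρ
    · rw [Set.indicator_of_mem hx]
    · rw [Set.indicator_of_notMem hx, stationaryAc_eq,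
        if_neg fun h => hx (mem_ball_zero_iff.2 h)]
  classical
  rw [h, ← Set.piecewise_eq_indicator]
  exact (continuousOn_stationaryAc a ρ).measurable_piecewise continuousOn_const
    measurableSet_ball

/-! ### The density for a fixed positive number of events -/

/-- The radial profile of the density of the flight (with `c t = 1`), given that exactly `n + 1`
events occurred, divided by `(n + 1)!`. -/
def condDensity : ℕ → ℝ → ℝ
  | 0, z => 16 / Real.pi ^ 3 * (1 - 5 / 6 * z)
  | n + 1, z => 1 / (2 * Real.pi ^ 3) * seriesTerm 1 z (n + 2)

lemma continuous_condDensity (n : ℕ) : Continuous (condDensity n) := by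
  cases n with
  | zero => unfold condDensity; fun_prop
  | succ n =>
    have := (continuous_seriesTerm n).comp (Continuous.prodMk_right (1 : ℝ))
    exact continuous_const.mul this

lemma integrableOn_ball_of_continuous {f : E 6 → ℝ} (hf : Continuous f) (ρ : ℝ) :
    IntegrableOn f (Metric.ball 0 ρ) :=
  (hf.continuousOn.integrableOn_compact (isCompact_closedBall 0 ρ)).mono_set
    Metric.ball_subset_closedBall

lemma continuous_inner_pow_mul_radial (α : E 6) (l : ℕ) (ρ : ℝ) {f : ℝ → ℝ} (hf : Continuous f) :
    Continuous fun x : E 6 => (inner ℝ α x) ^ l * f (‖x‖ ^ 2 / ρ ^ 2) := by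
  fun_prop

-- Each profile is a polynomial in `‖x‖² / ρ²`, so polar integration applies monomial by monomial.
-- The even moments are the two algebraic identities `sphereMoment_mul_one_switch` and
-- `sphereMoment_mul_sum`; the odd ones vanish on both sides.
open PowerSeries in
lemma setIntegral_ball_inner_pow_mul_condDensity (α : E 6) (n l : ℕ) {ρ : ℝ} (hρ : 0 < ρ) :
    ∫ x in Metric.ball (0 : E 6) ρ, (inner ℝ α x) ^ l * condDensity n (‖x‖ ^ 2 / ρ ^ 2)
      = ρ ^ (l + 6) * ‖α‖ ^ l
        * ((l ! : ℝ) / ((l + (n + 1))! : ℝ) * coeff l (momentSeries ^ (n + 2))) := by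
  have hpow : ∀ i : ℕ, IntegrableOn (fun x : E 6 => (inner ℝ α x) ^ l * (‖x‖ ^ 2 / ρ ^ 2) ^ i)
      (Metric.ball 0 ρ) := fun i => integrableOn_ball_of_continuous
        (continuous_inner_pow_mul_radial α l ρ (continuous_pow i)) ρ
  cases n with
  | zero =>
    have h1 : ∀ x : E 6, (inner ℝ α x) ^ l * condDensity 0 (‖x‖ ^ 2 / ρ ^ 2)
        = 16 / Real.pi ^ 3 * ((inner ℝ α x) ^ l * (‖x‖ ^ 2 / ρ ^ 2) ^ 0)
          - 16 / Real.pi ^ 3 * (5 / 6) * ((inner ℝ α x) ^ l * (‖x‖ ^ 2 / ρ ^ 2) ^ 1) := by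
      intro x
      rw [condDensity]
      ring
    simp_rw [h1]
    rw [integral_sub ((hpow 0).const_mul _) ((hpow 1).const_mul _), integral_const_mul,
      integral_const_mul, integral_inner_pow_mul_norm_pow_ball α l 0 hρ,
      integral_inner_pow_mul_norm_pow_ball α l 1 hρ]
    have hpi := Real.pi_ne_zero
    rcases Nat.even_or_odd' l with ⟨j, rfl | rfl⟩
    · have h2 := sphereMoment_mul_one_switch j
      rw [zero_add, zero_add, ← h2]
      have : (j : ℝ) + 3 ≠ 0 := by positivity
      have : (j : ℝ) + 4 ≠ 0 := by positivity
      push_cast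
      rw [show 2 * (j : ℝ) + 2 * 0 + 6 = 2 * (j + 3) by ring,
        show 2 * (j : ℝ) + 2 * 1 + 6 = 2 * (j + 4) by ring]
      field_simp
      ring
    · rw [coeff_momentSeries_pow_odd]
      simp [sphereMoment]
  | succ n =>
    have h1 : ∀ x : E 6, (inner ℝ α x) ^ l * condDensity (n + 1) (‖x‖ ^ 2 / ρ ^ 2)
        = ∑ k ∈ Finset.range (n + 2 + 2), ∑ i ∈ Finset.range (n + 2 + k - 2 + 1),
          (1 / (2 * Real.pi ^ 3) * innerCoeff (n + 2) k * hypCoeff (n + 2 + k - 2) k i)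
            * ((inner ℝ α x) ^ l * (‖x‖ ^ 2 / ρ ^ 2) ^ i) := by
      intro x
      rw [condDensity, seriesTerm_eq _ _ _ (by omega)]
      simp only [Finset.mul_sum]
      refine Finset.sum_congr rfl fun k _ => Finset.sum_congr rfl fun i _ => ?_
      rw [one_pow]
      ring
    simp_rw [h1]
    rw [integral_finsetSum _ fun k _ => integrable_finsetSum _ fun i _ => (hpow i).const_mul _]
    simp_rw [integral_finsetSum _ fun i _ => (hpow i).const_mul _, integral_const_mul,
      integral_inner_pow_mul_norm_pow_ball α l _ hρ]
    rcases Nat.even_or_odd' l with ⟨j, rfl | rfl⟩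
    · have h2 := sphereMoment_mul_sum (n + 2) j (by omega)
      rw [show n + 1 + 2 = n + 2 + 1 by ring, show n + 1 + 1 = n + 2 by ring, ← h2]
      simp only [Finset.mul_sum]
      refine Finset.sum_congr rfl fun k _ => Finset.sum_congr rfl fun i _ => ?_
      have hpi := Real.pi_ne_zero
      have : (i : ℝ) + j + 3 ≠ 0 := by positivity
      push_cast
      rw [show 2 * (j : ℝ) + 2 * i + 6 = 2 * (i + j + 3) by ring]
      field_simp
      ring
    · rw [coeff_momentSeries_pow_odd]
      simp [sphereMoment]

/-- The density of the flight with `a = λ t`, `ρ = c t` on the event that exactly `n + 1` events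
occurred. -/
def flightDensity (a ρ : ℝ) (n : ℕ) : E 6 → ℝ :=
  (Metric.ball (0 : E 6) ρ).indicator fun x =>
    Real.exp (-a) * a ^ (n + 1) / ρ ^ 6 * condDensity n (‖x‖ ^ 2 / ρ ^ 2)

lemma measurable_flightDensity (a ρ : ℝ) (n : ℕ) : Measurable (flightDensity a ρ n) := by
  refine Measurable.indicator (Continuous.measurable ?_) measurableSet_ball
  exact continuous_const.mul ((continuous_condDensity n).comp (by fun_prop))

lemma inner_pow_mul_flightDensity (a ρ : ℝ) (n : ℕ) (α : E 6) (l : ℕ) (x : E 6) :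
    (inner ℝ α x) ^ l * flightDensity a ρ n x
      = (Metric.ball (0 : E 6) ρ).indicator (fun x => Real.exp (-a) * a ^ (n + 1) / ρ ^ 6
          * ((inner ℝ α x) ^ l * condDensity n (‖x‖ ^ 2 / ρ ^ 2))) x := by
  rw [flightDensity]
  by_cases hx : x ∈ Metric.ball (0 : E 6) ρ
  · rw [Set.indicator_of_mem hx, Set.indicator_of_mem hx]; ring
  · rw [Set.indicator_of_notMem hx, Set.indicator_of_notMem hx, mul_zero]

lemma integrable_inner_pow_mul_flightDensity (a ρ : ℝ) (n : ℕ) (α : E 6) (l : ℕ) :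
    Integrable fun x => (inner ℝ α x) ^ l * flightDensity a ρ n x := by
  simp_rw [inner_pow_mul_flightDensity]
  rw [integrable_indicator_iff measurableSet_ball]
  exact integrableOn_ball_of_continuous (continuous_const.mul
    (continuous_inner_pow_mul_radial α l ρ (continuous_condDensity n))) ρ

open PowerSeries in
lemma integral_inner_pow_mul_flightDensity (a : ℝ) {ρ : ℝ} (hρ : 0 < ρ) (n : ℕ) (α : E 6) (l : ℕ) :
    ∫ x, (inner ℝ α x) ^ l * flightDensity a ρ n x
      = Real.exp (-a) * a ^ (n + 1) * (ρ ^ l * ‖α‖ ^ l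
        * ((l ! : ℝ) / ((l + (n + 1))! : ℝ) * coeff l (momentSeries ^ (n + 1 + 1)))) := by
  simp_rw [inner_pow_mul_flightDensity]
  rw [integral_indicator measurableSet_ball, integral_const_mul,
    setIntegral_ball_inner_pow_mul_condDensity α n l hρ]
  field_simp
  ring

lemma seriesTerm_eq_pow_mul (a z : ℝ) (n : ℕ) : seriesTerm a z n = a ^ n * seriesTerm 1 z n := by
  simp only [seriesTerm, one_pow, one_mul, mul_assoc]

lemma hasSum_flightDensity (a ρ : ℝ) (x : E 6) :
    HasSum (fun n => flightDensity a ρ n x) (stationaryAc a ρ x) := by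
  rw [stationaryAc_eq]
  by_cases hx : ‖x‖ < ρ
  · have hρ : 0 < ρ := (norm_nonneg x).trans_lt hx
    have hz := radial_mem hx
    rw [if_pos hx]
    set z := ‖x‖ ^ 2 / ρ ^ 2 with hz'
    have hval : ∀ n, flightDensity a ρ n x = Real.exp (-a) * a ^ (n + 1) / ρ ^ 6 * condDensity n z :=
      fun n => Set.indicator_of_mem (mem_ball_zero_iff.2 hx) _
    simp_rw [hval]
    -- Index zero is the one-switch term, written separately in the closed formula; the tail is the
    -- outer series.
    rw [← hasSum_nat_add_iff' 1]
    have h1 := ((summable_seriesTerm a hz.le).hasSum).mul_left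
      (Real.exp (-a) / (Real.pi ^ 3 * ρ ^ 6) * (1 / 2))
    have hpi := Real.pi_ne_zero
    convert! h1 using 1
    · funext n
      rw [condDensity, seriesTerm_eq_pow_mul a]
      field_simp
    · simp only [Finset.range_one, Finset.sum_singleton, condDensity, radialAc]
      field_simp
      ring
  · rw [if_neg hx]
    have hval : ∀ n, flightDensity a ρ n x = 0 :=
      fun n => Set.indicator_of_notMem (fun h => hx (mem_ball_zero_iff.1 h)) _
    simp_rw [hval]
    exact hasSum_zero

/-! ### Identification of the law of the flight -/

/-- The distribution of the position of the flight, restricted to the event that exactly `n` events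
occurred. -/
def branchLaw (lam c t : ℝ) (n : ℕ) : Measure (E 6) :=
  ((inputLaw 6 lam).restrict (countEvent 6 t n)).map (positionAt c t n)

lemma integral_inner_pow_branchLaw (lam c t : ℝ) (n : ℕ) (α : E 6) (l : ℕ) :
    ∫ x, (inner ℝ α x) ^ l ∂branchLaw lam c t n = flightMoment lam c α n l t := by
  rw [branchLaw, integral_map (measurable_positionAt c t n).aemeasurable
    (Measurable.aestronglyMeasurable (by fun_prop)), flightMoment]

lemma isFiniteMeasure_branchLaw {lam : ℝ} (hlam : 0 < lam) (c t : ℝ) (n : ℕ) :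
    IsFiniteMeasure (branchLaw lam c t n) := by
  have := isProbabilityMeasure_inputLaw (m := 6) hlam
  unfold branchLaw
  infer_instance

lemma ae_norm_le_branchLaw {lam c : ℝ} (hc : 0 ≤ c) (t : ℝ) (n : ℕ) :
    ∀ᵐ x ∂branchLaw lam c t n, ‖x‖ ≤ c * t := by
  rw [branchLaw, ae_map_iff (measurable_positionAt c t n).aemeasurable
    (measurableSet_le (by fun_prop) measurable_const)]
  filter_upwards [ae_restrict_mem (measurableSet_countEvent 6 t n)] with ω hω
  exact norm_positionAt_le hc hω

/-- The moments from the renewal equation and those of the explicit profile coincide. Nonnegativity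
of the profile is a by-product. -/
lemma branchLaw_succ {lam c t : ℝ} (hlam : 0 < lam) (hc : 0 < c) (ht : 0 < t) (n : ℕ) :
    (∀ᵐ x, 0 ≤ flightDensity (lam * t) (c * t) n x) ∧
      branchLaw lam c t (n + 1)
        = volume.withDensity fun x => ENNReal.ofReal (flightDensity (lam * t) (c * t) n x) := by
  have := isFiniteMeasure_branchLaw hlam c t (n + 1)
  refine eq_withDensity_of_integral_inner_pow (ae_norm_le_branchLaw hc.le t (n + 1))
    (measurable_flightDensity _ _ n) (fun x hx => ?_)
    (integrable_inner_pow_mul_flightDensity _ _ n) fun α l => ?_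
  · exact Set.indicator_of_notMem (fun h => (mem_ball_zero_iff.1 h).not_gt hx) _
  · rw [integral_inner_pow_branchLaw, flightMoment_eq hlam hc.le α (n + 1) l ht.le,
      integral_inner_pow_mul_flightDensity _ (mul_pos hc ht)]

lemma stationarySingular_eq (a : ℝ) {ρ : ℝ} (hρ : 0 < ρ) :
    stationarySingular a ρ = ENNReal.ofReal (Real.exp (-a)) •
      (uniformDirection 6).map fun u : UnitSphere 6 => ρ • (u : E 6) := by
  rw [stationarySingular, sphereSurface, uniformDirection, Measure.map_smul, toSphere_univ,
    smul_smul, smul_smul, ← ENNReal.ofReal_inv_of_pos (by positivity),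
    ← ENNReal.ofReal_mul (by positivity), ← ENNReal.ofReal_mul (by positivity)]
  congr 2
  field_simp

lemma measurable_smul_sphere (ρ : ℝ) : Measurable fun u : UnitSphere 6 => ρ • (u : E 6) := by
  fun_prop

lemma integral_stationarySingular (a : ℝ) {ρ : ℝ} (hρ : 0 < ρ) {f : E 6 → ℝ}
    (hf : Measurable f) :
    ∫ x, f x ∂stationarySingular a ρ
      = Real.exp (-a) * ∫ u : UnitSphere 6, f (ρ • (u : E 6)) ∂uniformDirection 6 := by
  rw [stationarySingular_eq a hρ, integral_smul_measure, integral_map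
    (measurable_smul_sphere ρ).aemeasurable hf.aestronglyMeasurable,
    ENNReal.toReal_ofReal (Real.exp_pos _).le, smul_eq_mul]

lemma isFiniteMeasure_stationarySingular (a : ℝ) {ρ : ℝ} (hρ : 0 < ρ) :
    IsFiniteMeasure (stationarySingular a ρ) := by
  rw [stationarySingular_eq a hρ]
  exact Measure.smul_finite _ ENNReal.ofReal_ne_top

lemma ae_norm_eq_stationarySingular (a : ℝ) {ρ : ℝ} (hρ : 0 < ρ) :
    ∀ᵐ x ∂stationarySingular a ρ, ‖x‖ = ρ := by
  rw [stationarySingular_eq a hρ]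
  refine Measure.ae_smul_measure ?_ _
  rw [ae_map_iff (measurable_smul_sphere ρ).aemeasurable
    (measurableSet_eq_fun (by fun_prop) measurable_const)]
  refine Eventually.of_forall fun u => ?_
  rw [norm_smul, Real.norm_of_nonneg hρ.le]
  simp

lemma mutuallySingular_stationarySingular (a : ℝ) {ρ : ℝ} (hρ : 0 < ρ) :
    stationarySingular a ρ ⟂ₘ volume := by
  refine ⟨(Metric.sphere 0 ρ)ᶜ, Metric.isClosed_sphere.measurableSet.compl, ?_, ?_⟩
  · have := ae_norm_eq_stationarySingular a hρ
    rw [ae_iff] at this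
    convert! this using 2
    ext x
    simp
  · rw [compl_compl]
    exact Measure.addHaar_sphere _ _ _

lemma branchLaw_zero {lam c t : ℝ} (hlam : 0 < lam) (hc : 0 < c) (ht : 0 < t) :
    branchLaw lam c t 0 = stationarySingular (lam * t) (c * t) := by
  have hct := mul_pos hc ht
  have := isFiniteMeasure_branchLaw hlam c t 0
  have := isFiniteMeasure_stationarySingular (lam * t) hct
  refine ext_of_integral_inner_pow (ae_norm_le_branchLaw hc.le t 0)
    ((ae_norm_eq_stationarySingular (lam * t) hct).mono fun x hx => hx.le) fun α l => ?_
  rw [integral_inner_pow_branchLaw, flightMoment_zero hlam c α l ht.le,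
    integral_stationarySingular _ hct (by fun_prop)]
  simp_rw [inner_smul_right, mul_pow]
  rw [integral_const_mul, integral_uniformDirection_inner_pow]
  ring

open Function in
lemma pairwise_disjoint_countEvent (m : ℕ) (t : ℝ) : Pairwise (Disjoint on countEvent m t) := by
  have key : ∀ i j : ℕ, i < j → Disjoint (countEvent m t i) (countEvent m t j) := by
    intro i j hij
    rw [Set.disjoint_left]
    rintro ω ⟨-, -, h1⟩ ⟨h2, h3, -⟩
    have : eventTime ω (i + 1) ≤ eventTime ω j :=
      Finset.sum_le_sum_of_subset_of_nonneg (Finset.range_mono hij)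
        fun k hk _ => (h2 k (Finset.mem_range.1 hk)).le
    linarith
  intro i j hij
  rcases lt_or_gt_of_ne hij with h | h
  · exact key i j h
  · exact (key j i h).symm

-- The zeroth moment: `momentSeries` has constant coefficient one, so only the Poisson weight is
-- left.
open PowerSeries in
lemma measureReal_countEvent {lam t : ℝ} (hlam : 0 < lam) (ht : 0 ≤ t) (n : ℕ) :
    (inputLaw 6 lam).real (countEvent 6 t n)
      = Real.exp (-(lam * t)) * ((lam * t) ^ n / (n ! : ℝ)) := by
  have h := flightMoment_eq hlam zero_le_one 0 n 0 ht
  simp only [flightMoment, pow_zero, integral_const, smul_eq_mul, mul_one, measureReal_restrict_apply_univ,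
    zero_add, one_mul, Nat.factorial_zero, Nat.cast_one, coeff_zero_eq_constantCoeff, map_pow] at h
  rw [h]
  have : constantCoeff momentSeries = 1 := by
    rw [← coeff_zero_eq_constantCoeff_apply, momentSeries, coeff_mk]
    simp [sphereMoment]
  rw [this]
  simp
  ring

/-- The Poisson weights sum to one, so no separate argument against infinitely many events in finite
time is needed. -/
lemma ae_mem_iUnion_countEvent {lam t : ℝ} (hlam : 0 < lam) (ht : 0 ≤ t) :
    ∀ᵐ ω ∂inputLaw 6 lam, ω ∈ ⋃ n, countEvent 6 t n := by
  have := isProbabilityMeasure_inputLaw (m := 6) hlam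
  have hmeas : MeasurableSet (⋃ n, countEvent 6 t n) :=
    MeasurableSet.iUnion fun n => measurableSet_countEvent 6 t n
  have hsum : HasSum (fun n : ℕ => Real.exp (-(lam * t)) * ((lam * t) ^ n / (n ! : ℝ))) 1 := by
    have h := (NormedSpace.expSeries_div_hasSum_exp (lam * t)).mul_left (Real.exp (-(lam * t)))
    rwa [← Real.exp_eq_exp_ℝ, ← Real.exp_add, neg_add_cancel, Real.exp_zero] at h
  refine (prob_compl_eq_zero_iff hmeas).2 ?_
  rw [measure_iUnion (pairwise_disjoint_countEvent 6 t) (measurableSet_countEvent 6 t)]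
  have h : ∀ n, inputLaw 6 lam (countEvent 6 t n)
      = ENNReal.ofReal (Real.exp (-(lam * t)) * ((lam * t) ^ n / (n ! : ℝ))) := fun n => by
    rw [← measureReal_countEvent hlam ht, ofReal_measureReal]
  simp_rw [h]
  rw [← ENNReal.ofReal_tsum_of_nonneg (fun n => by positivity) hsum.summable, hsum.tsum_eq,
    ENNReal.ofReal_one]

lemma ae_forall_pos {lam : ℝ} (hlam : 0 < lam) :
    ∀ᵐ ω ∂inputLaw 6 lam, ∀ k, 0 < (ω k).1 := by
  have := ProbabilityTheory.isProbabilityMeasure_expMeasure hlam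
  rw [ae_all_iff]
  intro k
  have hmp : MeasurePreserving (Function.eval k) (inputLaw 6 lam)
      ((ProbabilityTheory.expMeasure lam).prod (uniformDirection 6)) :=
    measurePreserving_eval_infinitePi _ k
  have h1 : ∀ᵐ s ∂ProbabilityTheory.expMeasure lam, 0 < s := by
    have h2 := expMeasure_real_Ioi hlam le_rfl
    rw [mul_zero, neg_zero, Real.exp_zero, measureReal_def, ENNReal.toReal_eq_one_iff] at h2
    exact (prob_compl_eq_zero_iff measurableSet_Ioi).2 h2
  exact (measurePreserving_fst.comp hmp).quasiMeasurePreserving.ae h1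

lemma eventCount_eq {m : ℕ} {t : ℝ} {n : ℕ} {ω : ℕ → ℝ × UnitSphere m}
    (h : ω ∈ countEvent m t n) (hpos : ∀ k, 0 < (ω k).1) : eventCount t ω = n := by
  have hmono : Monotone (eventTime ω) := monotone_nat_of_le_succ fun k => by
    rw [eventTime, eventTime, Finset.sum_range_succ]
    linarith [hpos k]
  have : {k : ℕ | eventTime ω (k + 1) ≤ t} = (Finset.range n : Set ℕ) := by
    ext k
    simp only [Set.mem_ofPred_eq, Finset.coe_range, Set.mem_Iio]
    constructor
    · intro hk
      by_contra hkn
      have := hmono (show n + 1 ≤ k + 1 by omega)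
      linarith [h.2.2]
    · intro hk
      exact (hmono (show k + 1 ≤ n by omega)).trans h.2.1
  rw [eventCount, this, Set.ncard_coe_finset, Finset.card_range]

lemma position_ae_eq_positionAt {lam : ℝ} (hlam : 0 < lam) (c t : ℝ) (n : ℕ) :
    position c t =ᵐ[(inputLaw 6 lam).restrict (countEvent 6 t n)] positionAt c t n := by
  filter_upwards [ae_restrict_mem (measurableSet_countEvent 6 t n),
    ae_restrict_of_ae (ae_forall_pos hlam)] with ω hω hpos
  rw [position, eventCount_eq hω hpos, positionAt]

lemma inputLaw_eq_sum {lam t : ℝ} (hlam : 0 < lam) (ht : 0 ≤ t) :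
    inputLaw 6 lam = Measure.sum fun n => (inputLaw 6 lam).restrict (countEvent 6 t n) := by
  rw [← Measure.restrict_iUnion (pairwise_disjoint_countEvent 6 t)
    (measurableSet_countEvent 6 t), Measure.restrict_eq_self_of_ae_mem
    (ae_mem_iUnion_countEvent hlam ht)]

/-- Without this, `Measure.map` would be zero by convention. On each `countEvent` the position
agrees almost everywhere with the plainly measurable `positionAt`. -/
lemma aemeasurable_position {lam t : ℝ} (hlam : 0 < lam) (c : ℝ) (ht : 0 ≤ t) :
    AEMeasurable (position c t) (inputLaw 6 lam) := by
  rw [inputLaw_eq_sum hlam ht, aemeasurable_sum_measure_iff]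
  exact fun n => (measurable_positionAt c t n).aemeasurable.congr
    (position_ae_eq_positionAt hlam c t n).symm

lemma isProbabilityMeasure_flightLaw {lam t : ℝ} (hlam : 0 < lam) (c : ℝ) (ht : 0 ≤ t) :
    IsProbabilityMeasure (flightLaw 6 lam c t) := by
  have := isProbabilityMeasure_inputLaw (m := 6) hlam
  exact Measure.isProbabilityMeasure_map (aemeasurable_position hlam c ht)

lemma flightLaw_eq_sum {lam t : ℝ} (hlam : 0 < lam) (c : ℝ) (ht : 0 ≤ t) :
    flightLaw 6 lam c t = Measure.sum (branchLaw lam c t) := by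
  have h := aemeasurable_position hlam c ht
  rw [inputLaw_eq_sum hlam ht] at h
  rw [flightLaw, inputLaw_eq_sum hlam ht, Measure.map_sum h]
  congr 1
  funext n
  exact Measure.map_congr (position_ae_eq_positionAt hlam c t n)

/-- The law of the flight in closed form. -/
theorem flightLaw_eq_stationaryLaw {lam c t : ℝ} (hlam : 0 < lam) (hc : 0 < c) (ht : 0 < t) :
    (∀ᵐ x, 0 ≤ stationaryAc (lam * t) (c * t) x) ∧
      flightLaw 6 lam c t = stationaryLaw (lam * t) (c * t) := by
  have hnn : ∀ᵐ x, ∀ n, 0 ≤ flightDensity (lam * t) (c * t) n x :=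
    ae_all_iff.2 fun n => (branchLaw_succ hlam hc ht n).1
  refine ⟨hnn.mono fun x hx => (hasSum_flightDensity _ _ x).nonneg hx, ?_⟩
  have h1 : Measure.sum (branchLaw lam c t)
      = branchLaw lam c t 0 + Measure.sum fun n => branchLaw lam c t (n + 1) := by
    ext s hs
    rw [Measure.sum_apply _ hs, Measure.add_apply, Measure.sum_apply _ hs,
      tsum_eq_zero_add' ENNReal.summable]
  rw [flightLaw_eq_sum hlam c ht.le, h1, branchLaw_zero hlam hc ht, stationaryLaw]
  congr 1
  simp_rw [(branchLaw_succ hlam hc ht _).2]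
  -- The sum of densities can be taken inside `ENNReal.ofReal` only because every branch density is
  -- nonnegative almost everywhere.
  rw [← withDensity_tsum fun n => (measurable_flightDensity _ _ n).ennreal_ofReal]
  refine withDensity_congr_ae ?_
  filter_upwards [hnn] with x hx
  rw [tsum_apply (Pi.summable.2 fun _ => ENNReal.summable), ← ENNReal.ofReal_tsum_of_nonneg hx
    (hasSum_flightDensity _ _ x).summable, (hasSum_flightDensity _ _ x).tsum_eq]

/-- The limit is an actual flight observed at time one, which transfers total mass and positivity to
it. -/
lemma stationaryLaw_eq_flightLaw {a ρ : ℝ} (ha : 0 < a) (hρ : 0 < ρ) :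
    stationaryLaw a ρ = flightLaw 6 a ρ 1 := by
  simpa using (flightLaw_eq_stationaryLaw ha hρ one_pos).2.symm

lemma isProbabilityMeasure_stationaryLaw {a ρ : ℝ} (ha : 0 < a) (hρ : 0 < ρ) :
    IsProbabilityMeasure (stationaryLaw a ρ) := by
  rw [stationaryLaw_eq_flightLaw ha hρ]
  exact isProbabilityMeasure_flightLaw ha ρ zero_le_one

lemma stationaryAc_eq_zero (a : ℝ) {ρ : ℝ} {x : E 6} (hx : ρ ≤ ‖x‖) : stationaryAc a ρ x = 0 := by
  rw [stationaryAc, if_neg hx.not_gt]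

/-- Almost everywhere nonnegativity becomes pointwise by continuity: a negative value in the open
ball would persist on a nonempty open set, which has positive volume. -/
lemma stationaryAc_nonneg {a ρ : ℝ} (ha : 0 < a) (hρ : 0 < ρ) (x : E 6) :
    0 ≤ stationaryAc a ρ x := by
  have hae : ∀ᵐ x, 0 ≤ stationaryAc a ρ x := by
    simpa using (flightLaw_eq_stationaryLaw ha hρ one_pos).1
  by_contra hneg
  have hx : x ∈ Metric.ball (0 : E 6) ρ := by
    by_contra hx
    exact hneg (stationaryAc_eq_zero a (not_lt.1 fun h => hx (mem_ball_zero_iff.2 h))).ge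
  have hopen := (continuousOn_stationaryAc a ρ).isOpen_inter_preimage Metric.isOpen_ball
    (isOpen_Iio (a := (0 : ℝ)))
  refine (hopen.measure_pos volume ⟨x, hx, not_le.1 hneg⟩).ne' ?_
  rw [ae_iff] at hae
  exact measure_mono_null (fun y hy => not_le.2 hy.2) hae

lemma singularPart_flightLaw {lam c t : ℝ} (hlam : 0 < lam) (hc : 0 < c) (ht : 0 < t) :
    (flightLaw 6 lam c t).singularPart volume = stationarySingular (lam * t) (c * t) :=
  (Measure.eq_singularPart (measurable_stationaryAc _ _).ennreal_ofReal
    (mutuallySingular_stationarySingular _ (mul_pos hc ht))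
    (flightLaw_eq_stationaryLaw hlam hc ht).2).symm

lemma isAcTransitionDensity_stationaryAc {lam c t : ℝ} (hlam : 0 < lam) (hc : 0 < c)
    (ht : 0 < t) :
    IsAcTransitionDensity 6 lam c t (stationaryAc (lam * t) (c * t)) where
  nonneg := stationaryAc_nonneg (mul_pos hlam ht) (mul_pos hc ht)
  continuousOn := continuousOn_stationaryAc _ _
  eq_zero _ hx := stationaryAc_eq_zero _ (not_lt.1 fun h => hx (mem_ball_zero_iff.2 h))
  ae_eq_rnDeriv := Measure.eq_rnDeriv (measurable_stationaryAc _ _).ennreal_ofReal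
    (mutuallySingular_stationarySingular _ (mul_pos hc ht))
    (flightLaw_eq_stationaryLaw hlam hc ht).2

lemma IsAcTransitionDensity.unique {m : ℕ} {lam c t : ℝ} {f g : E m → ℝ}
    (hf : IsAcTransitionDensity m lam c t f) (hg : IsAcTransitionDensity m lam c t g) : f = g := by
  have hae : f =ᵐ[volume] g := by
    filter_upwards [hf.ae_eq_rnDeriv, hg.ae_eq_rnDeriv] with x h1 h2
    exact (ENNReal.ofReal_eq_ofReal_iff (hf.nonneg x) (hg.nonneg x)).1 (h1.trans h2.symm)
  have heq := Measure.eqOn_open_of_ae_eq (ae_restrict_of_ae hae) Metric.isOpen_ball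
    hf.continuousOn hg.continuousOn
  funext x
  by_cases hx : x ∈ Metric.ball (0 : E m) (c * t)
  · exact heq hx
  · rw [hf.eq_zero x hx, hg.eq_zero x hx]

/-! ### Passage to the slow diffusion limit -/

lemma eventually_pos_slowDiffusion (a ρ : ℝ) :
    ∀ᶠ s : ℝ × ℝ × ℝ in slowDiffusion a ρ, 0 < s.1 ∧ 0 < s.2.1 ∧ 0 < s.2.2 := by
  have h : ∀ᶠ s : ℝ × ℝ × ℝ in (𝓝[>] (0 : ℝ)) ×ˢ (𝓝[>] (0 : ℝ)) ×ˢ (atTop : Filter ℝ),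
      0 < s.1 ∧ 0 < s.2.1 ∧ 0 < s.2.2 :=
    (eventually_mem_nhdsWithin (a := (0 : ℝ)) (s := Set.Ioi 0)).prod_mk
      ((eventually_mem_nhdsWithin (a := (0 : ℝ)) (s := Set.Ioi 0)).prod_mk
        (eventually_gt_atTop (0 : ℝ)))
  exact h.filter_mono (inf_le_left.trans inf_le_left)

/-- The law depends on the parameters only through these two products; the separate limits of `lam`,
`c`, `t` serve only to make them eventually positive. -/
lemma tendsto_slowDiffusion (a ρ : ℝ) :
    Tendsto (fun s : ℝ × ℝ × ℝ => (s.1 * s.2.2, s.2.1 * s.2.2)) (slowDiffusion a ρ)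
      (𝓝 (a, ρ)) := by
  rw [nhds_prod_eq]
  exact (tendsto_comap.mono_left (inf_le_left.trans inf_le_right)).prodMk
    (tendsto_comap.mono_left inf_le_right)

/-- Off the limiting sphere, the case distinction in the density is locally constant in the radius.
-/
lemma continuousAt_stationaryAc (a : ℝ) {ρ : ℝ} {x : E 6} (hx : ‖x‖ ≠ ρ) :
    ContinuousAt (fun q : ℝ × ℝ => stationaryAc q.1 q.2 x) (a, ρ) := by
  rcases lt_or_gt_of_ne hx with h | h
  · have hρ : 0 < ρ := (norm_nonneg x).trans_lt h
    have hρ' : ((a, ρ) : ℝ × ℝ).2 ≠ 0 := hρ.ne'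
    have heq : (fun q : ℝ × ℝ => Real.exp (-q.1) / (Real.pi ^ 3 * q.2 ^ 6)
        * radialAc q.1 (‖x‖ ^ 2 / q.2 ^ 2)) =ᶠ[𝓝 (a, ρ)] fun q => stationaryAc q.1 q.2 x := by
      filter_upwards [(isOpen_lt continuous_const continuous_snd).mem_nhds
        (show (a, ρ) ∈ {q : ℝ × ℝ | ‖x‖ < q.2} from h)] with q hq
      rw [stationaryAc_eq, if_pos hq]
    refine ContinuousAt.congr ?_ heq
    refine ContinuousAt.mul ?_ ?_
    · exact ContinuousAt.div (by fun_prop) (by fun_prop) (by positivity)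
    · exact ContinuousAt.comp (g := fun p : ℝ × ℝ => radialAc p.1 p.2)
        (f := fun q : ℝ × ℝ => (q.1, ‖x‖ ^ 2 / q.2 ^ 2))
        (continuousAt_radialAc a (radial_mem h))
        (continuousAt_fst.prodMk (ContinuousAt.div (by fun_prop) (by fun_prop) (by positivity)))
  · have heq : (fun _ : ℝ × ℝ => (0 : ℝ)) =ᶠ[𝓝 (a, ρ)] fun q => stationaryAc q.1 q.2 x := by
      filter_upwards [(isOpen_lt continuous_snd continuous_const).mem_nhds
        (show (a, ρ) ∈ {q : ℝ × ℝ | q.2 < ‖x‖} from h)] with q hq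
      exact (stationaryAc_eq_zero _ (le_of_lt hq)).symm
    exact continuousAt_const.congr heq

lemma tendsto_integral_stationarySingular (a : ℝ) {ρ : ℝ} (hρ : 0 < ρ) (g : E 6 →ᵇ ℝ) :
    Tendsto (fun q : ℝ × ℝ => ∫ x, g x ∂stationarySingular q.1 q.2) (𝓝 (a, ρ))
      (𝓝 (∫ x, g x ∂stationarySingular a ρ)) := by
  have hcont : Continuous fun q : ℝ × ℝ =>
      Real.exp (-q.1) * ∫ u : UnitSphere 6, g (q.2 • (u : E 6)) ∂uniformDirection 6 := by
    refine Continuous.mul (by fun_prop) (Continuous.comp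
      (g := fun r : ℝ => ∫ u : UnitSphere 6, g (r • (u : E 6)) ∂uniformDirection 6)
      ?_ continuous_snd)
    refine continuous_of_dominated (bound := fun _ => ‖g‖) (fun r => ?_)
      (fun r => Eventually.of_forall fun u => g.norm_coe_le_norm _) (integrable_const _)
      (Eventually.of_forall fun u => by fun_prop)
    exact (g.continuous.measurable.comp (measurable_smul_sphere r)).aestronglyMeasurable
  rw [integral_stationarySingular a hρ g.continuous.measurable]
  refine (hcont.tendsto (a, ρ)).congr' ?_
  filter_upwards [(isOpen_lt continuous_const continuous_snd).mem_nhds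
    (show (a, ρ) ∈ {q : ℝ × ℝ | 0 < q.2} from hρ)] with q hq
  rw [integral_stationarySingular q.1 hq g.continuous.measurable]

lemma tendsto_integral_mul_stationaryAc (a : ℝ) {ρ : ℝ} (hρ : 0 < ρ) (g : E 6 →ᵇ ℝ) :
    Tendsto (fun q : ℝ × ℝ => ∫ x, g x * stationaryAc q.1 q.2 x) (𝓝 (a, ρ))
      (𝓝 (∫ x, g x * stationaryAc a ρ x)) := by
  obtain ⟨K, hK, hbound⟩ := exists_radialAc_bound (|a| + 1)
  refine tendsto_integral_filter_of_dominated_convergence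
    -- A common bound for all parameters `q` with `|q.1| < |a| + 1` and `ρ / 2 < q.2 < 2 * ρ`: the
    -- upper radius bounds the support, the lower one the factor `1 / q.2 ^ 6`.
    ((Metric.ball (0 : E 6) (2 * ρ)).indicator fun _ =>
      ‖g‖ * (Real.exp (|a| + 1) / (Real.pi ^ 3 * (ρ / 2) ^ 6) * K)) ?_ ?_ ?_ ?_
  · exact Eventually.of_forall fun q => (g.continuous.measurable.mul
      (measurable_stationaryAc q.1 q.2)).aestronglyMeasurable
  · have h1 : ∀ᶠ q : ℝ × ℝ in 𝓝 (a, ρ), |q.1| < |a| + 1 :=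
      (isOpen_lt (by fun_prop) continuous_const).mem_nhds
        (show (a, ρ) ∈ {q : ℝ × ℝ | |q.1| < |a| + 1} by simp)
    have h2 : ∀ᶠ q : ℝ × ℝ in 𝓝 (a, ρ), ρ / 2 < q.2 :=
      (isOpen_lt continuous_const continuous_snd).mem_nhds
        (show (a, ρ) ∈ {q : ℝ × ℝ | ρ / 2 < q.2} from half_lt_self hρ)
    have h3 : ∀ᶠ q : ℝ × ℝ in 𝓝 (a, ρ), q.2 < 2 * ρ :=
      (isOpen_lt continuous_snd continuous_const).mem_nhds
        (show ρ < 2 * ρ by linarith)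
    filter_upwards [h1, h2, h3] with q hq1 hq2 hq3
    refine Eventually.of_forall fun x => ?_
    by_cases hx : ‖x‖ < q.2
    · rw [Set.indicator_of_mem (mem_ball_zero_iff.2 (hx.trans hq3)), norm_mul]
      have hq0 : 0 < q.2 := (half_pos hρ).trans hq2
      refine mul_le_mul (g.norm_coe_le_norm x) ?_ (norm_nonneg _) (norm_nonneg _)
      rw [stationaryAc_eq, if_pos hx, norm_mul, Real.norm_of_nonneg (by positivity)]
      refine mul_le_mul ?_ (hbound _ _ hq1.le (radial_mem hx).le) (norm_nonneg _) (by positivity)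
      gcongr
      exact (neg_le_abs _).trans hq1.le
    · rw [stationaryAc_eq_zero _ (not_lt.1 hx), mul_zero, norm_zero]
      exact Set.indicator_nonneg (fun _ _ => by positivity) x
  · rw [integrable_indicator_iff measurableSet_ball]
    exact integrableOn_const measure_ball_lt_top.ne
  · have hne : ∀ᵐ x : E 6, ‖x‖ ≠ ρ := by
      rw [ae_iff]
      convert! Measure.addHaar_sphere (volume : Measure (E 6)) 0 ρ using 2
      ext x
      simp
    filter_upwards [hne] with x hx
    exact ((continuousAt_stationaryAc a hx).tendsto).const_mul (g x)

lemma integral_stationaryLaw {a ρ : ℝ} (ha : 0 < a) (hρ : 0 < ρ) (g : E 6 →ᵇ ℝ) :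
    ∫ x, g x ∂stationaryLaw a ρ
      = ∫ x, g x ∂stationarySingular a ρ + ∫ x, g x * stationaryAc a ρ x := by
  have := isProbabilityMeasure_stationaryLaw ha hρ
  have hint : Integrable g (stationaryLaw a ρ) := g.integrable _
  rw [stationaryLaw] at hint ⊢
  rw [integral_add_measure hint.left_of_add_measure hint.right_of_add_measure,
    integral_withDensity_ofReal (measurable_stationaryAc a ρ)]
  simp_rw [max_eq_left (stationaryAc_nonneg ha hρ _)]

end

end RandomFlight

open RandomFlight in
theorem mainTheorem4 :
    (∀ lam c t : ℝ, 0 < lam → 0 < c → 0 < t →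
      ∃! f : E 6 → ℝ, IsAcTransitionDensity 6 lam c t f) ∧
    ∀ a ρ : ℝ, 0 < a → 0 < ρ →
      -- the double series converges inside the ball
      (∀ x : E 6, ‖x‖ < ρ → Summable fun n : ℕ => seriesTerm a (‖x‖ ^ 2 / ρ ^ 2) (n + 2)) ∧
      -- the limit is a probability distribution, with nonnegative density
      (∀ x : E 6, 0 ≤ stationaryAc a ρ x) ∧
      IsProbabilityMeasure (stationaryLaw a ρ) ∧
      -- pointwise convergence of the absolutely continuous part of the transition density
      (∀ p : ℝ → ℝ → ℝ → E 6 → ℝ,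
        (∀ lam c t : ℝ, 0 < lam → 0 < c → 0 < t →
          IsAcTransitionDensity 6 lam c t (p lam c t)) →
        ∀ x : E 6, ‖x‖ ≠ ρ →
          Tendsto (fun s : ℝ × ℝ × ℝ => p s.1 s.2.1 s.2.2 x) (slowDiffusion a ρ)
            (𝓝 (stationaryAc a ρ x))) ∧
      -- convergence of the singular part, as a generalized function
      (∀ g : E 6 →ᵇ ℝ,
        Tendsto
          (fun s : ℝ × ℝ × ℝ => ∫ x, g x ∂((flightLaw 6 s.1 s.2.1 s.2.2).singularPart volume))
          (slowDiffusion a ρ) (𝓝 (∫ x, g x ∂(stationarySingular a ρ)))) ∧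
      -- convergence of the whole distribution
      (∀ g : E 6 →ᵇ ℝ,
        Tendsto (fun s : ℝ × ℝ × ℝ => ∫ x, g x ∂(flightLaw 6 s.1 s.2.1 s.2.2))
          (slowDiffusion a ρ) (𝓝 (∫ x, g x ∂(stationaryLaw a ρ)))) := by
  refine ⟨fun lam c t hlam hc ht => ⟨_, isAcTransitionDensity_stationaryAc hlam hc ht,
    fun f hf => hf.unique (isAcTransitionDensity_stationaryAc hlam hc ht)⟩,
    fun a ρ ha hρ => ⟨fun x hx => summable_seriesTerm a (radial_mem hx).le,
      stationaryAc_nonneg ha hρ, isProbabilityMeasure_stationaryLaw ha hρ,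
      fun p hp x hx => ?_, fun g => ?_, fun g => ?_⟩⟩
  · refine ((continuousAt_stationaryAc a hx).tendsto.comp (tendsto_slowDiffusion a ρ)).congr' ?_
    filter_upwards [eventually_pos_slowDiffusion a ρ] with s ⟨h1, h2, h3⟩
    -- The continuous version is unique, so any admissible `p` is the closed formula.
    rw [(hp _ _ _ h1 h2 h3).unique (isAcTransitionDensity_stationaryAc h1 h2 h3)]
    rfl
  · refine ((tendsto_integral_stationarySingular a hρ g).comp (tendsto_slowDiffusion a ρ)).congr' ?_
    filter_upwards [eventually_pos_slowDiffusion a ρ] with s ⟨h1, h2, h3⟩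
    rw [singularPart_flightLaw h1 h2 h3]
    rfl
  · rw [integral_stationaryLaw ha hρ]
    refine (((tendsto_integral_stationarySingular a hρ g).add
      (tendsto_integral_mul_stationaryAc a hρ g)).comp (tendsto_slowDiffusion a ρ)).congr' ?_
    filter_upwards [eventually_pos_slowDiffusion a ρ] with s ⟨h1, h2, h3⟩
    rw [(flightLaw_eq_stationaryLaw h1 h2 h3).2,
      integral_stationaryLaw (mul_pos h1 h3) (mul_pos h2 h3)]
    rfl
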